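/- Let $k$ be a field of characteristic zero and let $L$ be a Lie algebra over $k$ with a decreasing filtration $L=L^1\supseteq L^2\supseteq\cdots$ such that $[L^i,L^j]\subseteq L^{i+j}$, all quotients $L_p=L/L^{p+1}$ are finite-dimensional, and $L$ is complete, i.e. $L\to\varprojlim_p L_p$ is bijective. Notation. Filter the enveloping algebra $U(L)$ by the two-sided ideals $F^1=U(L)_+$ (the augmentation ideal), $F^{p+1}=F^p\cdot U(L)_++(L^{p+1})$, and likewise each $U(L_p)$, where $L_p$ has the induced filtration. Put $\hat U(L)=\varprojlim_p U(L)/F^p$, with product $\bullet$ and augmentation ideal $\hat U(L)_+$; on $\hat U(L)_+$, respectively $1+\hat U(L)_+$, let $\exp^\bullet$ and $\log^\bullet$ be given by the usual power series. Let $K=\varinjlim_p \mathrm{Hom}_k(L_p,k)$ and let $U^c(K)=\varinjlim_{j,p}\bigl(U(L_p)/F^{j+1}U(L_p)\bigr)^*$, viewed as a space of functionals on $U(L)$. It is a commutative Hopf algebra: its product (the shuffle product) is dual to the coproduct of $U(L)$, and its coproduct $\Delta_\bullet:U^c(K)\to U^c(K)\otimes_k U^c(K)$ is dual to the product of $U(L)$,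 that is, $\langle\Delta_\bullet f,u\otimes v\rangle=f(uv)$. Let $e=\log^\star(\mathbf 1)=J-J^{\star2}/2+J^{\star3}/3-\cdots$ be the Euler map of $U^c(K)$, where $\mathbf 1=\eta\circ\epsilon+J$ is the identity and $\star$ is convolution, and let $\mathrm{res}:U^c(K)\to K$ be restriction of functionals from $U(L)$ to $L$. The space $L\cong\mathrm{Hom}_k(K,k)$ is regarded as an affine variety with coordinate ring $\mathrm{Sym}(K)$, and $L\times L\cong\mathrm{Hom}_k(K\oplus K,k)$ as an affine variety with coordinate ring $\mathrm{Sym}(K\oplus K)\cong\mathrm{Sym}(K)\otimes_k\mathrm{Sym}(K)$. A map $f:V_1\to V_2$ between affine spaces $V_i=\mathrm{Hom}_k(W_i,k)$ is a morphism of varieties if there are exhaustive increasing filtrations of $W_1$ and $W_2$ by finite-dimensional subspaces, starting at $0$, such that for the dual decreasing filtrations $V_1^i$, $V_2^i$ the map $f$ descends for every $i$ to a polynomial map $V_1/V_1^i\to V_2/V_2^i$. The corresponding homomorphism of coordinate rings $f^\sharp:\mathrm{Sym}(W_2)\to\mathrm{Sym}(W_1)$ is the pullback of polynomial functions along $f$.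 Proposition. 1. There is an isomorphism of algebras $\psi:\mathrm{Sym}(K)\to U^c(K)$ whose restriction to $K$ is the section of $\mathrm{res}$ determined by the Euler map: $\mathrm{res}(\psi(\kappa))=\kappa$ for $\kappa\in K$, and $\psi(\mathrm{res}(f))=e(f)$ for $f\in U^c(K)$. 2. For all $a,b\in L$ there is exactly one element $\mu(a,b)\in L$ whose image in $\hat U(L)$ is $\log^\bullet(\exp^\bullet(a)\bullet\exp^\bullet(b))$. The resulting map $\mu:L\times L\to L$ is a morphism of varieties, and it has exactly one corresponding homomorphism of coordinate rings $\mu^\sharp:\mathrm{Sym}(K)\to\mathrm{Sym}(K\oplus K)$. 3. Under the identification $\psi$ of the coordinate ring of $L$ with $U^c(K)$, and the identification $\psi\otimes\psi$ of the coordinate ring of $L\times L$ with $U^c(K)\otimes_k U^c(K)$, the homomorphism $\mu^\sharp$ is the coproduct $\Delta_\bullet$: one has $(\psi\otimes\psi)\circ\mu^\sharp=\Delta_\bullet\circ\psi$. -/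

import Mathlib

open scoped TensorProduct

noncomputable section

attribute [local instance 100] LieRing.ofAssociativeRing

namespace UniversalEnvelopingAlgebra

variable {k : Type*} [Field k] {L : Type*} [LieRing L] [LieAlgebra k L]

theorem hom_ext_ι {A : Type*} [Ring A] [Algebra k A]
    {f g : UniversalEnvelopingAlgebra k L →ₐ[k] A} (h : ∀ x, f (ι k x) = g (ι k x)) : f = g :=
  hom_ext k (LieHom.ext h)

theorem adjoin_ι : Algebra.adjoin k (Set.range (ι k : L → UniversalEnvelopingAlgebra k L)) = ⊤ := by
  set S := Algebra.adjoin k (Set.range (ι k : L → UniversalEnvelopingAlgebra k L)) with hS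
  let f : L →ₗ⁅k⁆ S :=
    { toFun := fun x => ⟨ι k x, Algebra.subset_adjoin ⟨x, rfl⟩⟩
      map_add' := fun x y => by ext; exact map_add _ x y
      map_smul' := fun r x => by ext; exact map_smul _ r x
      map_lie' := fun {x y} => by ext; exact LieHom.map_lie (ι k) x y }
  have h : S.val.comp (lift k f) = AlgHom.id k _ := hom_ext_ι fun x => by
    rw [AlgHom.comp_apply, lift_ι_apply]; rfl
  refine top_unique fun u _ => ?_
  rw [← AlgHom.id_apply (R := k) u, ← h]
  exact (lift k f u).2

theorem eq_top_of_left (M : Submodule k (UniversalEnvelopingAlgebra k L)) (h1 : 1 ∈ M)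
    (h : ∀ (x : L), ∀ u ∈ M, ι k x * u ∈ M) (u : UniversalEnvelopingAlgebra k L) : u ∈ M := by
  let S : Subalgebra k (UniversalEnvelopingAlgebra k L) :=
    { carrier := {u | ∀ v ∈ M, u * v ∈ M}
      mul_mem' := fun {a b} ha hb v hv => by rw [mul_assoc]; exact ha _ (hb _ hv)
      add_mem' := fun {a b} ha hb v hv => by rw [add_mul]; exact M.add_mem (ha _ hv) (hb _ hv)
      algebraMap_mem' := fun r v hv => by rw [← Algebra.smul_def]; exact M.smul_mem _ hv }
  have hS : Algebra.adjoin k (Set.range (ι k : L → UniversalEnvelopingAlgebra k L)) ≤ S :=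
    Algebra.adjoin_le (by rintro _ ⟨x, rfl⟩; exact h x)
  rw [adjoin_ι] at hS
  simpa using hS (show u ∈ ⊤ from trivial) 1 h1

theorem eq_top_of_right (M : Submodule k (UniversalEnvelopingAlgebra k L)) (h1 : 1 ∈ M)
    (h : ∀ (x : L), ∀ u ∈ M, u * ι k x ∈ M) (u : UniversalEnvelopingAlgebra k L) : u ∈ M := by
  let S : Subalgebra k (UniversalEnvelopingAlgebra k L) :=
    { carrier := {u | ∀ v ∈ M, v * u ∈ M}
      mul_mem' := fun {a b} ha hb v hv => by rw [← mul_assoc]; exact hb _ (ha _ hv)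
      add_mem' := fun {a b} ha hb v hv => by rw [mul_add]; exact M.add_mem (ha _ hv) (hb _ hv)
      algebraMap_mem' := fun r v hv => by
        rw [← Algebra.commutes, ← Algebra.smul_def]; exact M.smul_mem _ hv }
  have hS : Algebra.adjoin k (Set.range (ι k : L → UniversalEnvelopingAlgebra k L)) ≤ S :=
    Algebra.adjoin_le (by rintro _ ⟨x, rfl⟩; exact h x)
  rw [adjoin_ι] at hS
  simpa using hS (show u ∈ ⊤ from trivial) 1 h1

/-- The coproduct on generators, `x ↦ x ⊗ 1 + 1 ⊗ x`. -/
def comulLie : L →ₗ⁅k⁆ (UniversalEnvelopingAlgebra k L ⊗[k] UniversalEnvelopingAlgebra k L) where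
  toFun x := ι k x ⊗ₜ 1 + 1 ⊗ₜ ι k x
  map_add' x y := by simp only [map_add, TensorProduct.add_tmul, TensorProduct.tmul_add]; abel
  map_smul' r x := by simp [TensorProduct.smul_tmul']
  map_lie' {x y} := by
    simp only [LieHom.map_lie, LieRing.of_associative_ring_bracket, mul_add, add_mul,
      Algebra.TensorProduct.tmul_mul_tmul, one_mul, mul_one, TensorProduct.sub_tmul,
      TensorProduct.tmul_sub]
    abel

instance instBialgebra : Bialgebra k (UniversalEnvelopingAlgebra k L) :=
  .ofAlgHom (lift k comulLie) (lift k 0)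
    (hom_ext_ι fun x => by
      simp [comulLie, Algebra.TensorProduct.one_def, TensorProduct.add_tmul,
        TensorProduct.tmul_add, -ι_apply, lift_ι_apply]
      abel)
    (hom_ext_ι fun x => by simp [comulLie, -ι_apply, lift_ι_apply])
    (hom_ext_ι fun x => by simp [comulLie, -ι_apply, lift_ι_apply])

theorem comul_ι (x : L) : Coalgebra.comul (R := k) (ι k x) =
    ι k x ⊗ₜ[k] (1 : UniversalEnvelopingAlgebra k L) + 1 ⊗ₜ[k] ι k x :=
  lift_ι_apply k _ x

theorem counit_ι (x : L) : Coalgebra.counit (R := k) (ι k x) = 0 :=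
  lift_ι_apply k _ x

instance instIsCocomm : Coalgebra.IsCocomm k (UniversalEnvelopingAlgebra k L) where
  comm_comp_comul := by
    have h : (Algebra.TensorProduct.comm k (UniversalEnvelopingAlgebra k L) _).toAlgHom.comp
        (Bialgebra.comulAlgHom k _) = Bialgebra.comulAlgHom k (UniversalEnvelopingAlgebra k L) :=
      hom_ext_ι fun x => by simp [comul_ι, -ι_apply, add_comm]
    exact congr(($h).toLinearMap)

/-- The antipode `x ↦ -x` on generators, as a map to the opposite algebra. -/
def antipodeOp : UniversalEnvelopingAlgebra k L →ₐ[k] (UniversalEnvelopingAlgebra k L)ᵐᵒᵖ :=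
  lift k
    { toFun := fun x => MulOpposite.op (-ι k x)
      map_add' := fun x y => by rw [map_add, neg_add, MulOpposite.op_add]
      map_smul' := fun r x => by rw [map_smul, ← smul_neg, MulOpposite.op_smul]; rfl
      map_lie' := fun {x y} => by
        simp only [LieHom.map_lie, LieRing.of_associative_ring_bracket, ← MulOpposite.op_mul,
          ← MulOpposite.op_sub]
        congr 1
        noncomm_ring }

/-- The antipode of the enveloping algebra. -/
def antipodeLin : UniversalEnvelopingAlgebra k L →ₗ[k] UniversalEnvelopingAlgebra k L :=
  (MulOpposite.opLinearEquiv k).symm.toLinearMap ∘ₗ antipodeOp.toLinearMap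

theorem antipodeLin_ι (x : L) : antipodeLin (ι k x) = -ι k x := by
  simp [antipodeLin, antipodeOp, lift_ι_apply, -ι_apply]

theorem antipodeLin_mul (u v : UniversalEnvelopingAlgebra k L) :
    antipodeLin (u * v) = antipodeLin v * antipodeLin u := by
  simp [antipodeLin]

theorem antipodeLin_one : antipodeLin (1 : UniversalEnvelopingAlgebra k L) = 1 := by
  simp [antipodeLin]

instance instHopfAlgebra : HopfAlgebra k (UniversalEnvelopingAlgebra k L) where
  antipode := antipodeLin
  mul_antipode_rTensor_comul := by
    ext u
    refine eq_top_of_left (LinearMap.eqLocus _ _) ?_ (fun x u _ => ?_) u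
    · simp [Algebra.TensorProduct.one_def, antipodeLin_one]
    · have key : ∀ t : UniversalEnvelopingAlgebra k L ⊗[k] UniversalEnvelopingAlgebra k L,
          LinearMap.mul' k _ (antipodeLin.rTensor _ ((ι k x ⊗ₜ[k] 1 + 1 ⊗ₜ[k] ι k x) * t)) = 0 := by
        intro t
        induction t with
        | zero => simp
        | add a b ha hb => rw [mul_add, map_add, map_add, ha, hb, add_zero]
        | tmul a b =>
          simp [add_mul, antipodeLin_mul, antipodeLin_ι, mul_assoc, -ι_apply]
      simp [LinearMap.mem_eqLocus, comul_ι, key, counit_ι, -ι_apply]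
  mul_antipode_lTensor_comul := by
    ext u
    refine eq_top_of_right (LinearMap.eqLocus _ _) ?_ (fun x u _ => ?_) u
    · simp [Algebra.TensorProduct.one_def, antipodeLin_one]
    · have key : ∀ t : UniversalEnvelopingAlgebra k L ⊗[k] UniversalEnvelopingAlgebra k L,
          LinearMap.mul' k _ (antipodeLin.lTensor _ (t * (ι k x ⊗ₜ[k] 1 + 1 ⊗ₜ[k] ι k x))) = 0 := by
        intro t
        induction t with
        | zero => simp
        | add a b ha hb => rw [add_mul, map_add, map_add, ha, hb, add_zero]
        | tmul a b =>
          simp [mul_add, antipodeLin_mul, antipodeLin_ι, ← mul_assoc, -ι_apply]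
      simp [LinearMap.mem_eqLocus, comul_ι, key, counit_ι, -ι_apply]


/-- The augmentation ideal `U₊`. -/
def aug (k L : Type*) [Field k] [LieRing L] [LieAlgebra k L] :
    Ideal (UniversalEnvelopingAlgebra k L) :=
  RingHom.ker (Bialgebra.counitAlgHom k (UniversalEnvelopingAlgebra k L))

instance instTwoSidedAug : (aug k L).IsTwoSided := inferInstanceAs (RingHom.ker _).IsTwoSided

theorem mem_aug {u : UniversalEnvelopingAlgebra k L} :
    u ∈ aug k L ↔ Coalgebra.counit (R := k) u = 0 := Iff.rfl

theorem ι_mem_aug (x : L) : ι k x ∈ aug k L := counit_ι x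

/-- The two-sided ideal of the enveloping algebra generated by a subspace of the Lie algebra. -/
def gen (S : Submodule k L) : Ideal (UniversalEnvelopingAlgebra k L) :=
  (TwoSidedIdeal.span (ι k '' (S : Set L))).asIdeal

instance instTwoSidedGen (S : Submodule k L) : (gen S).IsTwoSided :=
  inferInstanceAs (TwoSidedIdeal.asIdeal _).IsTwoSided

theorem ι_mem_gen {S : Submodule k L} {x : L} (hx : x ∈ S) : ι k x ∈ gen S :=
  TwoSidedIdeal.mem_asIdeal.2 (TwoSidedIdeal.subset_span ⟨x, hx, rfl⟩)

theorem gen_le {S : Submodule k L} {I : Ideal (UniversalEnvelopingAlgebra k L)} [I.IsTwoSided]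
    (h : ∀ x ∈ S, ι k x ∈ I) : gen S ≤ I := by
  intro u hu
  have h2 : TwoSidedIdeal.span (ι k '' (S : Set L)) ≤ I.toTwoSided :=
    TwoSidedIdeal.span_le.2 (by rintro _ ⟨x, hx, rfl⟩; simpa using h x hx)
  simpa using h2 (TwoSidedIdeal.mem_asIdeal.1 hu)

theorem gen_mono {S T : Submodule k L} (h : S ≤ T) : gen S ≤ gen T :=
  gen_le fun _ hx => ι_mem_gen (h hx)

theorem gen_le_aug (S : Submodule k L) : gen S ≤ aug k L := gen_le fun x _ => ι_mem_aug x

/-- The filtration `F¹ = U₊`, `F^{p+1} = F^p · U₊ + (L^{p+1})` of the enveloping algebra by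
two-sided ideals that is induced by a decreasing filtration `G` of the Lie algebra (the value at
`0` is only there to start the indexing). -/
def fil (G : ℕ → Submodule k L) : ℕ → Ideal (UniversalEnvelopingAlgebra k L)
  | 0 => ⊤
  | 1 => aug k L
  | p + 2 => fil G (p + 1) * aug k L ⊔ gen (G (p + 2))

theorem isTwoSided_sup {R : Type*} [Ring R] (I J : Ideal R) [I.IsTwoSided] [J.IsTwoSided] :
    (I ⊔ J).IsTwoSided :=
  ⟨fun {a} b ha => by
    obtain ⟨x, hx, y, hy, rfl⟩ := Submodule.mem_sup.1 ha
    rw [add_mul]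
    exact add_mem (Ideal.mem_sup_left (I.mul_mem_right b hx))
      (Ideal.mem_sup_right (J.mul_mem_right b hy))⟩

instance instTwoSidedFil (G : ℕ → Submodule k L) : ∀ p, (fil G p).IsTwoSided
  | 0 => inferInstanceAs (⊤ : Ideal _).IsTwoSided
  | 1 => inferInstanceAs (aug k L).IsTwoSided
  | p + 2 => by
    have := instTwoSidedFil G (p + 1)
    exact isTwoSided_sup _ _

theorem fil_le_aug (G : ℕ → Submodule k L) : ∀ p, fil G (p + 1) ≤ aug k L
  | 0 => le_rfl
  | p + 1 => by
    refine sup_le ?_ (gen_le_aug _)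
    exact Ideal.mul_le.2 fun a _ b hb => Ideal.mul_mem_left _ _ hb

theorem fil_succ_le (G : ℕ → Submodule k L) (hG : Antitone G) : ∀ p, fil G (p + 1) ≤ fil G p
  | 0 => le_top
  | 1 => fil_le_aug G 1
  | p + 2 =>
    sup_le_sup (Ideal.mul_mono_left (fil_succ_le G hG (p + 1))) (gen_mono (hG (Nat.le_succ _)))

theorem aug_pow_le_fil (G : ℕ → Submodule k L) : ∀ p, aug k L ^ p ≤ fil G p
  | 0 => le_top
  | 1 => by rw [Submodule.pow_one]; exact le_rfl
  | p + 2 => by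
    rw [Submodule.pow_succ]
    exact (Ideal.mul_mono_left (aug_pow_le_fil G (p + 1))).trans le_sup_left

theorem gen_le_fil (G : ℕ → Submodule k L) : ∀ p, gen (G p) ≤ fil G p
  | 0 => le_top
  | 1 => gen_le_aug _
  | _ + 2 => le_sup_right

theorem aug_pow_anti {m n : ℕ} (h : m ≤ n) : aug k L ^ n ≤ aug k L ^ m := by
  induction n, h using Nat.le_induction with
  | base => exact le_rfl
  | succ n _ ih => rw [Submodule.pow_succ]; exact Ideal.mul_le_left.trans ih

/-- The ideals `U₊^n + (L^n)`, cofinal with the filtration `fil`. -/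
def cof (G : ℕ → Submodule k L) (n : ℕ) : Ideal (UniversalEnvelopingAlgebra k L) :=
  aug k L ^ n ⊔ gen (G n)

instance instTwoSidedCof (G : ℕ → Submodule k L) (n : ℕ) : (cof G n).IsTwoSided :=
  isTwoSided_sup _ _

theorem cof_anti (G : ℕ → Submodule k L) (hG : Antitone G) : Antitone (cof G) :=
  fun _ _ h => sup_le_sup (aug_pow_anti h) (gen_mono (hG h))

theorem aug_pow_le_cof (G : ℕ → Submodule k L) (n : ℕ) : aug k L ^ n ≤ cof G n := le_sup_left

theorem cof_le_fil (G : ℕ → Submodule k L) (p : ℕ) : cof G p ≤ fil G p :=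
  sup_le (aug_pow_le_fil G p) (gen_le_fil G p)

theorem fil_add_le (G : ℕ → Submodule k L) (hG : Antitone G) (m : ℕ) :
    ∀ q, fil G (m + 1 + q) ≤ aug k L ^ (q + 1) ⊔ gen (G m)
  | 0 => by
    rw [zero_add, Submodule.pow_one]
    exact (fil_le_aug G m).trans le_sup_left
  | q + 1 => by
    have e : m + 1 + (q + 1) = m + q + 2 := by omega
    rw [e]
    refine sup_le ?_ ((gen_mono (hG (by omega))).trans le_sup_right)
    have ih := fil_add_le G hG m q
    rw [show m + 1 + q = m + q + 1 by omega] at ih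
    refine Ideal.mul_le.2 fun a ha b hb => ?_
    obtain ⟨x, hx, y, hy, rfl⟩ := Submodule.mem_sup.1 (ih ha)
    rw [add_mul]
    refine add_mem (Ideal.mem_sup_left ?_) (Ideal.mem_sup_right (Ideal.mul_mem_right _ _ hy))
    rw [Submodule.pow_succ]
    exact Ideal.mul_mem_mul hx hb

theorem fil_le_cof (G : ℕ → Submodule k L) (hG : Antitone G) (n : ℕ) :
    fil G (n + 1 + n) ≤ cof G n :=
  (fil_add_le G hG n n).trans (sup_le_sup (aug_pow_anti (Nat.le_succ n)) le_rfl)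

/-- `∑_{i + j ≥ n} U₊^i ⊗ U₊^j`. -/
def tensFil (k L : Type*) [Field k] [LieRing L] [LieAlgebra k L] (n : ℕ) :
    Submodule k (UniversalEnvelopingAlgebra k L ⊗[k] UniversalEnvelopingAlgebra k L) :=
  Submodule.span k {t | ∃ i j, n ≤ i + j ∧ ∃ a ∈ aug k L ^ i, ∃ b ∈ aug k L ^ j, t = a ⊗ₜ b}

theorem tensFil_mul {m n : ℕ}
    {s t : UniversalEnvelopingAlgebra k L ⊗[k] UniversalEnvelopingAlgebra k L}
    (hs : s ∈ tensFil k L m) (ht : t ∈ tensFil k L n) : s * t ∈ tensFil k L (m + n) := by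
  have h := Submodule.mul_mem_mul hs ht
  rw [tensFil, tensFil, Submodule.span_mul_span] at h
  refine Submodule.span_mono ?_ h
  rintro _ ⟨_, ⟨i, j, hij, a, ha, b, hb, rfl⟩, _, ⟨i', j', hij', a', ha', b', hb', rfl⟩, rfl⟩
  refine ⟨i + i', j + j', by omega, a * a', ?_, b * b', ?_,
    Algebra.TensorProduct.tmul_mul_tmul _ _ _ _⟩
  · rw [Ideal.IsTwoSided.pow_add]; exact Ideal.mul_mem_mul ha ha'
  · rw [Ideal.IsTwoSided.pow_add]; exact Ideal.mul_mem_mul hb hb'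

theorem sub_counit_mem_aug (u : UniversalEnvelopingAlgebra k L) :
    u - algebraMap k _ (Coalgebra.counit u) ∈ aug k L := by
  rw [mem_aug, map_sub, Bialgebra.counit_algebraMap, sub_self]

theorem tens_sub_mem (t : UniversalEnvelopingAlgebra k L ⊗[k] UniversalEnvelopingAlgebra k L) :
    t - algebraMap k _ (LinearMap.mul' k k
      (TensorProduct.map Coalgebra.counit Coalgebra.counit t)) ∈ tensFil k L 1 := by
  induction t with
  | zero => simp
  | add a b ha hb =>
    rw [map_add, map_add, map_add, add_sub_add_comm]
    exact add_mem ha hb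
  | tmul a b =>
    have h1 : (a - algebraMap k _ (Coalgebra.counit a)) ⊗ₜ[k] b ∈ tensFil k L 1 :=
      Submodule.subset_span ⟨1, 0, le_rfl, _, by
        rw [Submodule.pow_one]; exact sub_counit_mem_aug a, b, by
        rw [Submodule.pow_zero, Ideal.one_eq_top]; trivial, rfl⟩
    have h2 : (1 : UniversalEnvelopingAlgebra k L) ⊗ₜ[k]
        (b - algebraMap k _ (Coalgebra.counit b)) ∈ tensFil k L 1 :=
      Submodule.subset_span ⟨0, 1, le_rfl, 1, by
        rw [Submodule.pow_zero, Ideal.one_eq_top]; trivial, _, by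
        rw [Submodule.pow_one]; exact sub_counit_mem_aug b, rfl⟩
    have h3 := add_mem h1 (Submodule.smul_mem _ (Coalgebra.counit (R := k) a) h2)
    convert h3 using 1
    rw [TensorProduct.sub_tmul, TensorProduct.tmul_sub, smul_sub, TensorProduct.map_tmul,
      LinearMap.mul'_apply, Algebra.algebraMap_eq_smul_one, Algebra.algebraMap_eq_smul_one,
      Algebra.algebraMap_eq_smul_one, TensorProduct.tmul_smul, ← TensorProduct.smul_tmul',
      mul_smul, Algebra.TensorProduct.one_def]
    abel

theorem comul_mem_tensFil_one {u : UniversalEnvelopingAlgebra k L} (hu : u ∈ aug k L) :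
    Coalgebra.comul (R := k) u ∈ tensFil k L 1 := by
  have h := tens_sub_mem (Coalgebra.comul (R := k) u)
  have e : LinearMap.mul' k k (TensorProduct.map Coalgebra.counit Coalgebra.counit
      (Coalgebra.comul (R := k) u)) = Coalgebra.counit u := by
    rw [← LinearMap.lTensor_comp_rTensor, LinearMap.comp_apply, Coalgebra.rTensor_counit_comul]
    simp
  rwa [e, mem_aug.1 hu, map_zero, sub_zero] at h

theorem comul_mem_tensFil : ∀ (n : ℕ) {u : UniversalEnvelopingAlgebra k L}, u ∈ aug k L ^ n →
    Coalgebra.comul (R := k) u ∈ tensFil k L n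
  | 0, u, _ => by
    induction Coalgebra.comul (R := k) u with
    | zero => exact zero_mem _
    | add a b ha hb => exact add_mem ha hb
    | tmul a b =>
      refine Submodule.subset_span ⟨0, 0, le_rfl, a, ?_, b, ?_, rfl⟩ <;>
      · rw [Submodule.pow_zero, Ideal.one_eq_top]; trivial
  | n + 1, u, hu => by
    rw [Submodule.pow_succ] at hu
    refine Submodule.mul_induction_on hu (fun a ha b hb => ?_) fun a b ha hb => ?_
    · rw [Bialgebra.comul_mul]
      exact tensFil_mul (comul_mem_tensFil n ha) (comul_mem_tensFil_one hb)
    · rw [map_add]; exact add_mem ha hb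

/-- Modulo `cof G m ⊗ U + U ⊗ cof G n`, the coproduct kills `cof G (m + n)`. -/
theorem comul_cof (G : ℕ → Submodule k L) (hG : Antitone G) (m n : ℕ)
    {u : UniversalEnvelopingAlgebra k L} (hu : u ∈ cof G (m + n)) :
    TensorProduct.map (Ideal.Quotient.mkₐ k (cof G m)).toLinearMap
      (Ideal.Quotient.mkₐ k (cof G n)).toLinearMap (Coalgebra.comul (R := k) u) = 0 := by
  let φ := (Algebra.TensorProduct.map (Ideal.Quotient.mkₐ k (cof G m))
      (Ideal.Quotient.mkₐ k (cof G n))).comp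
      (Bialgebra.comulAlgHom k (UniversalEnvelopingAlgebra k L))
  suffices h : cof G (m + n) ≤ RingHom.ker φ from h hu
  refine sup_le (fun u hu => ?_) (gen_le fun x hx => ?_)
  · have h := comul_mem_tensFil _ hu
    have h2 : tensFil k L (m + n) ≤ LinearMap.ker (Algebra.TensorProduct.map
        (Ideal.Quotient.mkₐ k (cof G m)) (Ideal.Quotient.mkₐ k (cof G n))).toLinearMap := by
      refine Submodule.span_le.2 ?_
      rintro _ ⟨i, j, hij, a, ha, b, hb, rfl⟩
      have : m ≤ i ∨ n ≤ j := by omega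
      change Ideal.Quotient.mk (cof G m) a ⊗ₜ[k] Ideal.Quotient.mk (cof G n) b = 0
      rcases this with h | h
      · rw [Ideal.Quotient.eq_zero_iff_mem.2 (aug_pow_le_cof G m (aug_pow_anti h ha)),
          TensorProduct.zero_tmul]
      · rw [Ideal.Quotient.eq_zero_iff_mem.2 (aug_pow_le_cof G n (aug_pow_anti h hb)),
          TensorProduct.tmul_zero]
    exact h2 h
  · change φ (ι k x) = 0
    have e1 : Ideal.Quotient.mk (cof G m) (ι k x) = 0 := Ideal.Quotient.eq_zero_iff_mem.2
      (Ideal.mem_sup_right (ι_mem_gen (hG (Nat.le_add_right m n) hx)))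
    have e2 : Ideal.Quotient.mk (cof G n) (ι k x) = 0 := Ideal.Quotient.eq_zero_iff_mem.2
      (Ideal.mem_sup_right (ι_mem_gen (hG (Nat.le_add_left n m) hx)))
    simp [φ, comul_ι, -ι_apply, e1, e2]

/-- The quotient of an enveloping algebra of a finite-dimensional Lie algebra by an ideal
containing a power of the augmentation ideal is finite-dimensional. -/
theorem finite_quotient [FiniteDimensional k L] (I : Ideal (UniversalEnvelopingAlgebra k L))
    [I.IsTwoSided] (n : ℕ) (h : aug k L ^ n ≤ I) :
    Module.Finite k (UniversalEnvelopingAlgebra k L ⧸ I) := by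
  let V : Submodule k (UniversalEnvelopingAlgebra k L) :=
    1 ⊔ LinearMap.range (ι k : L →ₗ⁅k⁆ UniversalEnvelopingAlgebra k L).toLinearMap
  have hV : V.FG := by
    refine Submodule.FG.sup ?_ ?_
    · rw [Submodule.one_eq_span]; exact Submodule.fg_span_singleton _
    · rw [LinearMap.range_eq_map]; exact (Module.Finite.fg_top).map _
  have key : ∀ n, ∀ u : UniversalEnvelopingAlgebra k L,
      ∃ v ∈ V ^ n, u - v ∈ aug k L ^ n := by
    have h1 : (1 : UniversalEnvelopingAlgebra k L) ∈ V := Submodule.mem_sup_left (Submodule.mem_one.2 ⟨1, map_one _⟩)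
    have h2 : ∀ u : UniversalEnvelopingAlgebra k L, ∃ v ∈ V, u - v ∈ aug k L ^ 2 := by
      intro u
      suffices hu : u ∈ V ⊔ (aug k L ^ 2).restrictScalars k by
        obtain ⟨v, hv, w, hw, rfl⟩ := Submodule.mem_sup.1 hu
        exact ⟨v, hv, by rw [add_sub_cancel_left]; exact hw⟩
      refine eq_top_of_left _ (Submodule.mem_sup_left h1) (fun x u hu => ?_) u
      obtain ⟨v, hv, w, hw, rfl⟩ := Submodule.mem_sup.1 hu
      obtain ⟨r, hr, _, ⟨y, rfl⟩, rfl⟩ := Submodule.mem_sup.1 hv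
      obtain ⟨r, rfl⟩ := Submodule.mem_one.1 hr
      rw [mul_add, mul_add]
      refine add_mem (add_mem ?_ ?_) ?_
      · rw [← Algebra.commutes, ← Algebra.smul_def]
        exact Submodule.smul_mem _ _ (Submodule.mem_sup_left (Submodule.mem_sup_right ⟨x, rfl⟩))
      · refine Submodule.mem_sup_right ?_
        change _ ∈ aug k L ^ 2
        rw [Submodule.pow_succ, Submodule.pow_one]
        exact Ideal.mul_mem_mul (ι_mem_aug x) (ι_mem_aug y)
      · exact Submodule.mem_sup_right (Ideal.mul_mem_left _ _ hw)
    have h3 : ∀ n, ∀ u ∈ aug k L ^ n, ∃ v ∈ V ^ n, u - v ∈ aug k L ^ (n + 1) := by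
      intro n
      induction n with
      | zero =>
        intro u _
        refine ⟨algebraMap k _ (Coalgebra.counit u), ?_, ?_⟩
        · rw [Submodule.pow_zero]; exact Submodule.algebraMap_mem _
        · rw [zero_add, Submodule.pow_one]; exact sub_counit_mem_aug u
      | succ n ih =>
        intro u hu
        rw [Submodule.pow_succ] at hu
        refine Submodule.mul_induction_on hu (fun a ha b hb => ?_) fun a b ha hb => ?_
        · obtain ⟨v, hv, hw⟩ := ih a ha
          obtain ⟨v', hv', hw'⟩ := h2 b
          refine ⟨v * v', ?_, ?_⟩
          · rw [pow_succ]; exact Submodule.mul_mem_mul hv hv'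
          · have e : a * b - v * v' = (a - v) * b + v * (b - v') := by noncomm_ring
            have hv2 : v ∈ aug k L ^ n := by
              rw [show v = a - (a - v) by abel]
              exact sub_mem ha (aug_pow_anti (Nat.le_succ n) hw)
            rw [e]
            refine add_mem ?_ ?_
            · rw [Submodule.pow_succ]; exact Ideal.mul_mem_mul hw hb
            · rw [show n + 1 + 1 = n + 2 by rfl, Ideal.IsTwoSided.pow_add]
              exact Ideal.mul_mem_mul hv2 hw'
        · obtain ⟨v, hv, hw⟩ := ha
          obtain ⟨v', hv', hw'⟩ := hb
          exact ⟨v + v', add_mem hv hv', by rw [add_sub_add_comm]; exact add_mem hw hw'⟩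
    intro n
    induction n with
    | zero =>
      intro u
      exact ⟨0, zero_mem _, by rw [Submodule.pow_zero, Ideal.one_eq_top]; trivial⟩
    | succ n ih =>
      intro u
      obtain ⟨v, hv, hw⟩ := ih u
      obtain ⟨v', hv', hw'⟩ := h3 n _ hw
      refine ⟨v + v', ?_, by rwa [← sub_sub]⟩
      rw [pow_succ, ← mul_one (v + v')]
      exact Submodule.mul_mem_mul (add_mem hv hv') h1
  have hs : Function.Surjective ((Ideal.Quotient.mkₐ k I).toLinearMap ∘ₗ (V ^ n).subtype) := by
    intro y
    obtain ⟨u, rfl⟩ := Ideal.Quotient.mk_surjective y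
    obtain ⟨v, hv, hw⟩ := key n u
    exact ⟨⟨v, hv⟩, ((Ideal.Quotient.mk_eq_mk_iff_sub_mem _ _).2 (h hw)).symm⟩
  have : Module.Finite k (V ^ n : Submodule k _) := Module.Finite.of_fg (hV.pow n)
  exact Module.Finite.of_surjective _ hs

end UniversalEnvelopingAlgebra

/-- A complete decreasing filtration `L = L¹ ⊇ L² ⊇ ⋯` of a Lie algebra with `[Lⁱ, Lʲ] ⊆ L^{i+j}`
and finite-dimensional quotients. The value at `0` (which equals `L` as well) is only there to
start the indexing. Completeness says that `L → lim L / L^{p+1}` is bijective. -/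
structure CompleteLieFiltration (k L : Type*) [Field k] [LieRing L] [LieAlgebra k L] where
  ideal : ℕ → LieIdeal k L
  one_eq_top : ideal 1 = ⊤
  antitone : Antitone ideal
  lie_mem : ∀ i j, ∀ x ∈ ideal i, ∀ y ∈ ideal j, ⁅x, y⁆ ∈ ideal (i + j)
  finite : ∀ p, FiniteDimensional k (L ⧸ ideal (p + 1))
  complete : ∀ x : ∀ p, L ⧸ ideal (p + 1),
    (∀ p, Submodule.factor (LieSubmodule.toSubmodule_le_toSubmodule _ _ |>.2
      (antitone (Nat.le_succ (p + 1)))) (x (p + 1)) = x p) →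
    ∃! y : L, ∀ p, LieSubmodule.Quotient.mk y = x p

namespace CompleteLieFiltration

open UniversalEnvelopingAlgebra (ι aug fil cof gen)
open Module (Dual)

variable {k : Type*} [Field k] {L : Type*} [LieRing L] [LieAlgebra k L]
variable (F : CompleteLieFiltration k L)

instance instFinite (p : ℕ) : FiniteDimensional k (L ⧸ F.ideal (p + 1)) := F.finite p

/-- The subspaces `Lⁱ`. -/
def sub (i : ℕ) : Submodule k L := (F.ideal i).toSubmodule

theorem sub_anti : Antitone F.sub := fun _ _ h => F.antitone h

/-- The quotient map `L → L_p = L / L^{p+1}`. -/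
def quotMap (p : ℕ) : L →ₗ⁅k⁆ L ⧸ F.ideal (p + 1) where
  __ := (F.ideal (p + 1)).toSubmodule.mkQ
  map_lie' := rfl

theorem quotMap_surjective (p : ℕ) : Function.Surjective (F.quotMap p) :=
  (F.ideal (p + 1)).toSubmodule.mkQ_surjective

theorem quotMap_eq_zero {p : ℕ} {x : L} : F.quotMap p x = 0 ↔ x ∈ F.sub (p + 1) :=
  Submodule.Quotient.mk_eq_zero _

/-- The induced filtration of `L_p`. -/
def quotSub (p i : ℕ) : Submodule k (L ⧸ F.ideal (p + 1)) := (F.sub i).map (F.quotMap p).toLinearMap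

theorem quotSub_anti (p : ℕ) : Antitone (F.quotSub p) := fun _ _ h =>
  Submodule.map_mono (F.sub_anti h)

/-! ### The dual Lie coalgebra `K` -/

/-- `K = colim (L_p)^*`, as the subspace of all functionals on `L` that factor through some
`L_p`. -/
def kSub : Submodule k (Dual k L) := ⨆ p, LinearMap.range (F.quotMap p).toLinearMap.dualMap

/-- The vector space `K`. -/
def K : Type _ := F.kSub

instance instAddCommGroupK : AddCommGroup F.K := inferInstanceAs (AddCommGroup F.kSub)

instance instModuleK : Module k F.K := inferInstanceAs (Module k F.kSub)

/-- The evaluation of elements of `K` on `L`. -/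
def kVal : F.K →ₗ[k] Dual k L := F.kSub.subtype

/-! ### The Hopf algebra `U^c(K)` -/

/-- `U^j(L_p) = U(L_p) / F^{j+1} U(L_p)`. -/
abbrev UQuot (j p : ℕ) : Type _ :=
  UniversalEnvelopingAlgebra k (L ⧸ F.ideal (p + 1)) ⧸ fil (F.quotSub p) (j + 1)

/-- The projection `U(L) → U^j(L_p)`. -/
def proj (j p : ℕ) : UniversalEnvelopingAlgebra k L →ₐ[k] F.UQuot j p :=
  (Ideal.Quotient.mkₐ k _).comp (UniversalEnvelopingAlgebra.lift k ((ι k).comp (F.quotMap p)))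

/-- `U^c(K) = colim U^j(L_p)^*`, as the subspace of all functionals on `U(L)` that factor through
some `U^j(L_p)`. -/
def ucSub : Submodule k (Dual k (UniversalEnvelopingAlgebra k L)) :=
  ⨆ j, ⨆ p, LinearMap.range (F.proj j p).toLinearMap.dualMap

theorem map_surjective (p : ℕ) : Function.Surjective
    (UniversalEnvelopingAlgebra.lift k ((ι k).comp (F.quotMap p))) := by
  rw [← AlgHom.range_eq_top, ← top_le_iff, ← UniversalEnvelopingAlgebra.adjoin_ι]
  refine Algebra.adjoin_le ?_
  rintro _ ⟨x, rfl⟩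
  obtain ⟨y, rfl⟩ := F.quotMap_surjective p x
  exact ⟨ι k y, UniversalEnvelopingAlgebra.lift_ι_apply k _ y⟩

theorem proj_surjective (j p : ℕ) : Function.Surjective (F.proj j p) :=
  (Ideal.Quotient.mkₐ_surjective k _).comp (F.map_surjective p)

theorem counit_map (p : ℕ) (u : UniversalEnvelopingAlgebra k L) :
    Coalgebra.counit (R := k) (UniversalEnvelopingAlgebra.lift k ((ι k).comp (F.quotMap p)) u) =
      Coalgebra.counit (R := k) u := by
  have h : (Bialgebra.counitAlgHom k _).comp
      (UniversalEnvelopingAlgebra.lift k ((ι k).comp (F.quotMap p))) =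
      Bialgebra.counitAlgHom k (UniversalEnvelopingAlgebra k L) :=
    UniversalEnvelopingAlgebra.hom_ext_ι fun x => by
      rw [AlgHom.comp_apply, UniversalEnvelopingAlgebra.lift_ι_apply]
      exact (UniversalEnvelopingAlgebra.counit_ι _).trans
        (UniversalEnvelopingAlgebra.counit_ι _).symm
  exact congr($h u)

theorem cof_le_ker_proj (j p n : ℕ) (hj : j + 1 ≤ n) (hp : p + 1 ≤ n) :
    cof F.sub n ≤ RingHom.ker (F.proj j p) := by
  refine sup_le ?_ (UniversalEnvelopingAlgebra.gen_le fun x hx => ?_)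
  · have h : ∀ n, ∀ u ∈ aug k L ^ n,
        UniversalEnvelopingAlgebra.lift k ((ι k).comp (F.quotMap p)) u ∈
          aug k (L ⧸ F.ideal (p + 1)) ^ n := by
      intro n
      induction n with
      | zero => intro u _; rw [Submodule.pow_zero, Ideal.one_eq_top]; trivial
      | succ n ih =>
        intro u hu
        rw [Submodule.pow_succ] at hu
        refine Submodule.mul_induction_on hu (fun a ha b hb => ?_) fun a b ha hb => ?_
        · rw [map_mul, Submodule.pow_succ]
          refine Ideal.mul_mem_mul (ih a ha) ?_
          rw [UniversalEnvelopingAlgebra.mem_aug, F.counit_map]; exact hb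
        · rw [map_add]; exact add_mem ha hb
    intro u hu
    exact Ideal.Quotient.eq_zero_iff_mem.2 (UniversalEnvelopingAlgebra.aug_pow_le_fil _ _
      (h _ u (UniversalEnvelopingAlgebra.aug_pow_anti hj hu)))
  · change Ideal.Quotient.mk _ (UniversalEnvelopingAlgebra.lift k _ (ι k x)) = 0
    rw [UniversalEnvelopingAlgebra.lift_ι_apply]
    have : F.quotMap p x = 0 := F.quotMap_eq_zero.2 (F.sub_anti hp hx)
    rw [LieHom.comp_apply, this, map_zero, map_zero]

theorem ker_proj_le_cof (n : ℕ) : RingHom.ker (F.proj (n + n) n) ≤ cof F.sub n := by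
  let θ : UniversalEnvelopingAlgebra k (L ⧸ F.ideal (n + 1)) →ₐ[k]
      UniversalEnvelopingAlgebra k L ⧸ cof F.sub n :=
    UniversalEnvelopingAlgebra.lift k
      { toLinearMap := (F.sub (n + 1)).liftQ
          ((Ideal.Quotient.mkₐ k (cof F.sub n)).toLinearMap ∘ₗ (ι k : L →ₗ⁅k⁆ _).toLinearMap)
          fun x hx => Ideal.Quotient.eq_zero_iff_mem.2 (Ideal.mem_sup_right
            (UniversalEnvelopingAlgebra.ι_mem_gen (F.sub_anti (Nat.le_succ n) hx)))
        map_lie' := fun {x y} => by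
          obtain ⟨x, rfl⟩ := F.quotMap_surjective n x
          obtain ⟨y, rfl⟩ := F.quotMap_surjective n y
          rw [← LieHom.map_lie]
          change Ideal.Quotient.mk _ (ι k ⁅x, y⁆) =
            ⁅Ideal.Quotient.mk (cof F.sub n) (ι k x), Ideal.Quotient.mk (cof F.sub n) (ι k y)⁆
          simp only [LieHom.map_lie, LieRing.of_associative_ring_bracket, map_sub, map_mul] }
  have hθι : ∀ x, θ (ι k (F.quotMap n x)) = Ideal.Quotient.mk _ (ι k x) := fun x =>
    UniversalEnvelopingAlgebra.lift_ι_apply k _ _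
  have hθ : ∀ u, θ (UniversalEnvelopingAlgebra.lift k ((ι k).comp (F.quotMap n)) u) =
      Ideal.Quotient.mk _ u := fun u => by
    have h : θ.comp (UniversalEnvelopingAlgebra.lift k ((ι k).comp (F.quotMap n))) =
        Ideal.Quotient.mkₐ k _ := UniversalEnvelopingAlgebra.hom_ext_ι fun x => by
      rw [AlgHom.comp_apply, UniversalEnvelopingAlgebra.lift_ι_apply]
      exact hθι x
    exact congr($h u)
  have hker : cof (F.quotSub n) n ≤ RingHom.ker θ := by
    refine sup_le (fun v hv => ?_) (UniversalEnvelopingAlgebra.gen_le ?_)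
    · have h : ∀ m, ∀ v ∈ aug k (L ⧸ F.ideal (n + 1)) ^ m, ∃ u ∈ aug k L ^ m,
          UniversalEnvelopingAlgebra.lift k ((ι k).comp (F.quotMap n)) u = v := by
        intro m
        induction m with
        | zero =>
          intro v _
          obtain ⟨u, rfl⟩ := F.map_surjective n v
          exact ⟨u, by rw [Submodule.pow_zero, Ideal.one_eq_top]; trivial, rfl⟩
        | succ m ih =>
          intro v hv
          rw [Submodule.pow_succ] at hv
          refine Submodule.mul_induction_on hv (fun a ha b hb => ?_) fun a b ha hb => ?_
          · obtain ⟨a, ha', rfl⟩ := ih a ha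
            obtain ⟨b, rfl⟩ := F.map_surjective n b
            rw [UniversalEnvelopingAlgebra.mem_aug, F.counit_map] at hb
            refine ⟨a * b, ?_, map_mul _ _ _⟩
            rw [Submodule.pow_succ]
            exact Ideal.mul_mem_mul ha' hb
          · obtain ⟨a, ha', rfl⟩ := ha
            obtain ⟨b, hb', rfl⟩ := hb
            exact ⟨a + b, add_mem ha' hb', map_add _ _ _⟩
      obtain ⟨u, hu, rfl⟩ := h n v hv
      rw [RingHom.mem_ker, hθ]
      exact Ideal.Quotient.eq_zero_iff_mem.2 (UniversalEnvelopingAlgebra.aug_pow_le_cof _ _ hu)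
    · rintro _ ⟨x, hx, rfl⟩
      rw [RingHom.mem_ker]
      exact (hθι x).trans (Ideal.Quotient.eq_zero_iff_mem.2 (Ideal.mem_sup_right
        (UniversalEnvelopingAlgebra.ι_mem_gen hx)))
  intro u hu
  have h1 := Ideal.Quotient.eq_zero_iff_mem.1 (show Ideal.Quotient.mk _ _ = 0 from hu)
  have h2 := hker (UniversalEnvelopingAlgebra.fil_le_cof _ (F.quotSub_anti n) n
    (by rwa [show n + 1 + n = n + n + 1 by omega]))
  rw [RingHom.mem_ker] at h2
  exact Ideal.Quotient.eq_zero_iff_mem.1 ((hθ u).symm.trans h2)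

theorem mem_ucSub {f : Dual k (UniversalEnvelopingAlgebra k L)} :
    f ∈ F.ucSub ↔ ∃ n, ∀ u ∈ cof F.sub n, f u = 0 := by
  constructor
  · intro hf
    let S : Submodule k (Dual k (UniversalEnvelopingAlgebra k L)) :=
      { carrier := {f | ∃ n, ∀ u ∈ cof F.sub n, f u = 0}
        zero_mem' := ⟨0, fun _ _ => rfl⟩
        smul_mem' := fun c f ⟨n, h⟩ => ⟨n, fun u hu => by
          rw [LinearMap.smul_apply, h u hu, smul_zero]⟩
        add_mem' := fun {f g} ⟨n, hf⟩ ⟨m, hg⟩ => ⟨max n m, fun u hu => by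
          rw [LinearMap.add_apply,
            hf u (UniversalEnvelopingAlgebra.cof_anti _ F.sub_anti (le_max_left n m) hu),
            hg u (UniversalEnvelopingAlgebra.cof_anti _ F.sub_anti (le_max_right n m) hu),
            add_zero]⟩ }
    refine (iSup_le fun j => iSup_le fun p => ?_ : F.ucSub ≤ S) hf
    rintro _ ⟨g, rfl⟩
    refine ⟨max (j + 1) (p + 1), fun u hu => ?_⟩
    have h := F.cof_le_ker_proj j p _ (le_max_left _ _) (le_max_right _ _) hu
    rw [RingHom.mem_ker] at h
    exact (congrArg g h).trans (map_zero g)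
  · rintro ⟨n, h⟩
    refine Submodule.mem_iSup_of_mem (n + n) (Submodule.mem_iSup_of_mem n ?_)
    rw [LinearMap.range_dualMap_eq_dualAnnihilator_ker]
    exact (Submodule.mem_dualAnnihilator f).2 fun u hu => h u (F.ker_proj_le_cof n hu)


/-- Functionals on a tensor product given by tensors of functionals. -/
theorem dualDistrib_injective {V W A B : Type*} [AddCommGroup V] [Module k V] [AddCommGroup W]
    [Module k W] [AddCommGroup A] [Module k A] [AddCommGroup B] [Module k B]
    (i : A →ₗ[k] Dual k V) (j : B →ₗ[k] Dual k W) (hi : Function.Injective i)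
    (hj : Function.Injective j) :
    Function.Injective (TensorProduct.dualDistrib k V W ∘ₗ TensorProduct.map i j) := by
  rw [← LinearMap.ker_eq_bot, LinearMap.ker_eq_bot']
  intro t ht
  have b := Module.Basis.ofVectorSpace k B
  obtain ⟨c, rfl⟩ := TensorProduct.eq_repr_basis_right b t
  have h : ∀ v w, c.sum (fun m a => i a v * j (b m) w) = 0 := fun v w => by
    have := congr($ht (v ⊗ₜ w))
    simpa [Finsupp.sum, LinearMap.sum_apply] using this
  have h2 : ∀ v, c.sum (fun m a => (i a v) • b m) = 0 := fun v => by
    apply hj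
    ext w
    simpa [Finsupp.sum, LinearMap.sum_apply] using h v w
  have h3 : ∀ m, c m = 0 := fun m => by
    apply hi
    ext v
    have := congr(b.repr $(h2 v) m)
    by_contra hne
    have hm : m ∈ c.support := Finsupp.mem_support_iff.2 fun h0 => hne (by simp [h0])
    rw [Finsupp.sum, map_sum, Finsupp.finsetSum_apply, Finset.sum_eq_single m] at this
    · exact hne (by simpa using this)
    · intro m' _ hm'
      simp [hm']
    · exact fun h => absurd hm h
  have : c = 0 := Finsupp.ext h3
  rw [this, Finsupp.sum_zero_index]

theorem conv_mem_ucSub {f g : WithConv (UniversalEnvelopingAlgebra k L →ₗ[k] k)}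
    (hf : f.ofConv ∈ F.ucSub) (hg : g.ofConv ∈ F.ucSub) : (f * g).ofConv ∈ F.ucSub := by
  rw [mem_ucSub] at hf hg ⊢
  obtain ⟨m, hm⟩ := hf
  obtain ⟨n, hn⟩ := hg
  have lift : ∀ (n : ℕ) (f : Dual k (UniversalEnvelopingAlgebra k L)),
      (∀ u ∈ cof F.sub n, f u = 0) →
      ∃ f', f = f' ∘ₗ (Ideal.Quotient.mkₐ k (cof F.sub n)).toLinearMap := by
    intro n f hf
    have : f ∈ LinearMap.range (Ideal.Quotient.mkₐ k (cof F.sub n)).toLinearMap.dualMap := by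
      rw [LinearMap.range_dualMap_eq_dualAnnihilator_ker]
      exact (Submodule.mem_dualAnnihilator f).2 fun u hu =>
        hf u (Ideal.Quotient.eq_zero_iff_mem.1 hu)
    obtain ⟨f', rfl⟩ := this
    exact ⟨f', rfl⟩
  obtain ⟨f', hf'⟩ := lift m _ hm
  obtain ⟨g', hg'⟩ := lift n _ hn
  refine ⟨m + n, fun u hu => ?_⟩
  have h := UniversalEnvelopingAlgebra.comul_cof F.sub F.sub_anti m n hu
  change LinearMap.mul' k k (TensorProduct.map f.ofConv g.ofConv (Coalgebra.comul u)) = 0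
  rw [hf', hg', TensorProduct.map_comp, LinearMap.comp_apply, h, map_zero, map_zero]

/-- `U^c(K)` as a subalgebra, under the convolution (shuffle) product dual to the coproduct of
`U(L)`, of the space of all functionals on `U(L)`. -/
def ucAlg : Subalgebra k (WithConv (UniversalEnvelopingAlgebra k L →ₗ[k] k)) where
  carrier := {f | f.ofConv ∈ F.ucSub}
  mul_mem' hf hg := F.conv_mem_ucSub hf hg
  add_mem' hf hg := F.ucSub.add_mem hf hg
  algebraMap_mem' r := F.mem_ucSub.2 ⟨1, fun u hu => by
    have h : cof F.sub 1 ≤ aug k L :=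
      (UniversalEnvelopingAlgebra.cof_le_fil F.sub 1)
    change r • algebraMap k k (Coalgebra.counit u) = 0
    rw [UniversalEnvelopingAlgebra.mem_aug.1 (h hu), map_zero, smul_zero]⟩

/-- The commutative algebra `U^c(K)`. -/
def Uc : Type _ := F.ucAlg

instance instCommRing : CommRing F.Uc := inferInstanceAs (CommRing F.ucAlg)

instance instAlgebra : Algebra k F.Uc := inferInstanceAs (Algebra k F.ucAlg)

/-- The evaluation of elements of `U^c(K)` on `U(L)`. -/
def incl : F.Uc →ₗ[k] Dual k (UniversalEnvelopingAlgebra k L) where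
  toFun f := f.1.ofConv
  map_add' _ _ := rfl
  map_smul' _ _ := rfl

theorem incl_injective : Function.Injective F.incl := fun _ _ h => Subtype.ext (WithConv.ext h)

theorem ext_incl {f g : F.Uc} (h : ∀ u, F.incl f u = F.incl g u) : f = g :=
  F.incl_injective (LinearMap.ext h)

theorem exists_kill (f : F.Uc) : ∃ n, ∀ u ∈ cof F.sub n, F.incl f u = 0 := F.mem_ucSub.1 f.2

theorem incl_one (u : UniversalEnvelopingAlgebra k L) : F.incl 1 u = Coalgebra.counit u := rfl

theorem incl_mul (f g : F.Uc) (u : UniversalEnvelopingAlgebra k L) :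
    F.incl (f * g) u = LinearMap.mul' k k
      (TensorProduct.map (F.incl f) (F.incl g) (Coalgebra.comul u)) := rfl

/-- The pairing of `U^c(K) ⊗ U^c(K)` with `U(L) ⊗ U(L)`. -/
def pair : F.Uc ⊗[k] F.Uc →ₗ[k]
    Dual k (UniversalEnvelopingAlgebra k L ⊗[k] UniversalEnvelopingAlgebra k L) :=
  TensorProduct.dualDistrib k _ _ ∘ₗ TensorProduct.map F.incl F.incl

theorem pair_tmul (f g : F.Uc) (u v : UniversalEnvelopingAlgebra k L) :
    F.pair (f ⊗ₜ g) (u ⊗ₜ v) = F.incl f u * F.incl g v := rfl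

theorem pair_injective : Function.Injective F.pair :=
  dualDistrib_injective _ _ F.incl_injective F.incl_injective

theorem pair_ext {s t : F.Uc ⊗[k] F.Uc} (h : ∀ u v, F.pair s (u ⊗ₜ v) = F.pair t (u ⊗ₜ v)) :
    s = t :=
  F.pair_injective (TensorProduct.ext' h)

instance instFiniteUQuot (j p : ℕ) : Module.Finite k (F.UQuot j p) :=
  UniversalEnvelopingAlgebra.finite_quotient _ (j + 1)
    (UniversalEnvelopingAlgebra.aug_pow_le_fil _ _)

theorem mul_mem_range_pair (f : F.Uc) :
    F.incl f ∘ₗ LinearMap.mul' k (UniversalEnvelopingAlgebra k L) ∈ LinearMap.range F.pair := by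
  obtain ⟨n, hn⟩ := F.exists_kill f
  have hf : F.incl f ∈ LinearMap.range (F.proj (n + n) n).toLinearMap.dualMap := by
    rw [LinearMap.range_dualMap_eq_dualAnnihilator_ker]
    exact (Submodule.mem_dualAnnihilator _).2 fun u hu => hn u (F.ker_proj_le_cof n hu)
  obtain ⟨g, hg⟩ := hf
  let r : Dual k (F.UQuot (n + n) n) →ₗ[k] F.Uc :=
    { toFun := fun φ => ⟨WithConv.toConv (φ ∘ₗ (F.proj (n + n) n).toLinearMap),
        Submodule.mem_iSup_of_mem (n + n) (Submodule.mem_iSup_of_mem n ⟨φ, rfl⟩)⟩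
      map_add' := fun _ _ => rfl
      map_smul' := fun _ _ => rfl }
  obtain ⟨t, ht⟩ := (TensorProduct.dualDistribEquiv k (F.UQuot (n + n) n)
    (F.UQuot (n + n) n)).surjective (g ∘ₗ LinearMap.mul' k _)
  have ht' : TensorProduct.dualDistrib k (F.UQuot (n + n) n) (F.UQuot (n + n) n) t =
      g ∘ₗ LinearMap.mul' k _ := ht
  refine ⟨TensorProduct.map r r t, TensorProduct.ext' fun u v => ?_⟩
  have h1 : ∀ s, F.pair (TensorProduct.map r r s) (u ⊗ₜ v) =
      TensorProduct.dualDistrib k (F.UQuot (n + n) n) (F.UQuot (n + n) n) s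
        (F.proj (n + n) n u ⊗ₜ F.proj (n + n) n v) := by
    intro s
    induction s with
    | zero => simp
    | add a b ha hb => simp only [map_add, LinearMap.add_apply, ha, hb]
    | tmul a b => rfl
  rw [h1, ht', ← hg]
  simp

/-- The coproduct `Δ_•` of `U^c(K)`: the unique map such that
`⟨Δ_• f, u ⊗ v⟩ = f (u v)` for all `u, v ∈ U(L)` (see `pair_comulUc`). -/
def comulUc : F.Uc →ₗ[k] F.Uc ⊗[k] F.Uc :=
  (LinearEquiv.ofInjective F.pair F.pair_injective).symm.toLinearMap ∘ₗ
    LinearMap.codRestrict (LinearMap.range F.pair)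
      ((LinearMap.mul' k (UniversalEnvelopingAlgebra k L)).dualMap ∘ₗ F.incl) F.mul_mem_range_pair

theorem pair_comulUc (f : F.Uc) (u v : UniversalEnvelopingAlgebra k L) :
    F.pair (F.comulUc f) (u ⊗ₜ v) = F.incl f (u * v) := by
  have h := LinearEquiv.apply_symm_apply (LinearEquiv.ofInjective F.pair F.pair_injective)
    (LinearMap.codRestrict (LinearMap.range F.pair)
      ((LinearMap.mul' k (UniversalEnvelopingAlgebra k L)).dualMap ∘ₗ F.incl)
      F.mul_mem_range_pair f)
  exact congr(($h).1 (u ⊗ₜ v))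

theorem pair_comulUc' (f : F.Uc)
    (x : UniversalEnvelopingAlgebra k L ⊗[k] UniversalEnvelopingAlgebra k L) :
    F.pair (F.comulUc f) x = F.incl f (LinearMap.mul' k _ x) := by
  have h : F.pair (F.comulUc f) = F.incl f ∘ₗ LinearMap.mul' k _ :=
    TensorProduct.ext' fun u v => by rw [pair_comulUc]; simp
  exact congr($h x)

theorem incl_mul' (t : F.Uc ⊗[k] F.Uc) (u : UniversalEnvelopingAlgebra k L) :
    F.incl (LinearMap.mul' k _ t) u = F.pair t (Coalgebra.comul u) := by
  induction t with
  | zero => simp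
  | add a b ha hb => simp only [map_add, LinearMap.add_apply, ha, hb]
  | tmul a b =>
    rw [LinearMap.mul'_apply, incl_mul]
    induction Coalgebra.comul (R := k) u with
    | zero => simp
    | add a b ha hb => simp only [map_add, ha, hb]
    | tmul a b => rfl

/-- The counit of `U^c(K)`, the value at `1 ∈ U(L)`. -/
def counitUc : F.Uc →ₗ[k] k := LinearMap.applyₗ (1 : UniversalEnvelopingAlgebra k L) ∘ₗ F.incl

theorem counitUc_apply (f : F.Uc) : F.counitUc f = F.incl f 1 := rfl

/-- The pairing of triple tensor products. -/
def pair₃ : F.Uc ⊗[k] (F.Uc ⊗[k] F.Uc) →ₗ[k] Dual k (UniversalEnvelopingAlgebra k L ⊗[k]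
    (UniversalEnvelopingAlgebra k L ⊗[k] UniversalEnvelopingAlgebra k L)) :=
  TensorProduct.dualDistrib k _ _ ∘ₗ TensorProduct.map F.incl F.pair

theorem pair₃_lTensor (t : F.Uc ⊗[k] F.Uc) (u v w : UniversalEnvelopingAlgebra k L) :
    F.pair₃ (F.comulUc.lTensor _ t) (u ⊗ₜ (v ⊗ₜ w)) = F.pair t (u ⊗ₜ (v * w)) := by
  induction t with
  | zero => simp
  | add a b ha hb => simp only [map_add, LinearMap.add_apply, ha, hb]
  | tmul a b =>
    rw [LinearMap.lTensor_tmul, pair_tmul, ← pair_comulUc]; rfl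

theorem pair₃_assoc (s : F.Uc ⊗[k] F.Uc) (b : F.Uc) (u v w : UniversalEnvelopingAlgebra k L) :
    F.pair₃ (TensorProduct.assoc k _ _ _ (s ⊗ₜ b)) (u ⊗ₜ (v ⊗ₜ w)) =
      F.pair s (u ⊗ₜ v) * F.incl b w := by
  induction s with
  | zero => simp
  | add a b ha hb => simp only [map_add, LinearMap.add_apply, TensorProduct.add_tmul, add_mul,
      ha, hb]
  | tmul a c => rw [pair_tmul, mul_assoc]; rfl

theorem pair₃_rTensor (t : F.Uc ⊗[k] F.Uc) (u v w : UniversalEnvelopingAlgebra k L) :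
    F.pair₃ (TensorProduct.assoc k _ _ _ (F.comulUc.rTensor _ t)) (u ⊗ₜ (v ⊗ₜ w)) =
      F.pair t ((u * v) ⊗ₜ w) := by
  induction t with
  | zero => simp
  | add a b ha hb => simp only [map_add, LinearMap.add_apply, ha, hb]
  | tmul a b => rw [LinearMap.rTensor_tmul, pair₃_assoc, pair_tmul, pair_comulUc]

instance instCoalgebra : Coalgebra k F.Uc where
  comul := F.comulUc
  counit := F.counitUc
  coassoc := by
    ext f
    apply dualDistrib_injective F.incl F.pair F.incl_injective F.pair_injective
    refine TensorProduct.ext_threefold' fun u v w => ?_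
    exact (F.pair₃_rTensor _ u v w).trans (((F.pair_comulUc f _ _).trans (by rw [mul_assoc])).trans
      ((F.pair₃_lTensor _ u v w).trans (F.pair_comulUc f _ _)).symm)
  rTensor_counit_comp_comul := by
    ext f
    have key : ∀ t : F.Uc ⊗[k] F.Uc, ∀ u,
        F.incl (TensorProduct.lid k _ (F.counitUc.rTensor _ t)) u = F.pair t (1 ⊗ₜ u) := by
      intro t u
      induction t with
      | zero => simp
      | add a b ha hb => simp only [map_add, LinearMap.add_apply, ha, hb]
      | tmul a b => simp [pair_tmul, counitUc_apply]
    apply (TensorProduct.lid k _).injective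
    refine F.ext_incl fun u => ?_
    refine (key _ u).trans ((F.pair_comulUc f _ _).trans ?_)
    simp
  lTensor_counit_comp_comul := by
    ext f
    have key : ∀ t : F.Uc ⊗[k] F.Uc, ∀ u,
        F.incl (TensorProduct.rid k _ (F.counitUc.lTensor _ t)) u = F.pair t (u ⊗ₜ 1) := by
      intro t u
      induction t with
      | zero => simp
      | add a b ha hb => simp only [map_add, LinearMap.add_apply, ha, hb]
      | tmul a b => simp [pair_tmul, counitUc_apply, mul_comm]
    apply (TensorProduct.rid k _).injective
    refine F.ext_incl fun u => ?_
    refine (key _ u).trans ((F.pair_comulUc f _ _).trans ?_)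
    simp

theorem map_incl_mul (f g : F.Uc)
    (x y : UniversalEnvelopingAlgebra k L ⊗[k] UniversalEnvelopingAlgebra k L) :
    LinearMap.mul' k k (TensorProduct.map (F.incl f) (F.incl g) (x * y)) =
      LinearMap.mul' k k (TensorProduct.map (F.pair (F.comulUc f)) (F.pair (F.comulUc g))
        (TensorProduct.tensorTensorTensorComm k _ _ _ _ (x ⊗ₜ y))) := by
  induction x with
  | zero => simp
  | add a b ha hb => simp only [add_mul, map_add, TensorProduct.add_tmul, ha, hb]
  | tmul a b =>
    induction y with
    | zero => simp
    | add a b ha hb => simp only [mul_add, map_add, TensorProduct.tmul_add, ha, hb]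
    | tmul c d => simp [pair_comulUc]

theorem pair_mul (s t : F.Uc ⊗[k] F.Uc) (u v : UniversalEnvelopingAlgebra k L) :
    F.pair (s * t) (u ⊗ₜ v) = LinearMap.mul' k k (TensorProduct.map (F.pair s) (F.pair t)
      (TensorProduct.tensorTensorTensorComm k _ _ _ _
        (Coalgebra.comul (R := k) u ⊗ₜ Coalgebra.comul (R := k) v))) := by
  induction s with
  | zero => simp
  | add a b ha hb => simp only [add_mul, map_add, LinearMap.add_apply, TensorProduct.map_add_left,
      ha, hb]
  | tmul a b =>
    induction t with
    | zero => simp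
    | add a b ha hb => simp only [mul_add, map_add, LinearMap.add_apply,
        TensorProduct.map_add_right, ha, hb]
    | tmul c d =>
      rw [Algebra.TensorProduct.tmul_mul_tmul, pair_tmul, incl_mul, incl_mul]
      induction Coalgebra.comul (R := k) u with
      | zero => simp
      | add x y hx hy => simp only [add_mul, map_add, TensorProduct.add_tmul, hx, hy]
      | tmul x y =>
        induction Coalgebra.comul (R := k) v with
        | zero => simp
        | add x y hx hy => simp only [mul_add, map_add, TensorProduct.tmul_add, hx, hy]
        | tmul z w => simp [pair_tmul]; ring

instance instBialgebra : Bialgebra k F.Uc :=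
  Bialgebra.mk' k F.Uc
    ((F.incl_one 1).trans Bialgebra.counit_one)
    (fun {f g} => by
      refine (F.incl_mul f g 1).trans ?_
      rw [Bialgebra.comul_one, Algebra.TensorProduct.one_def]; rfl)
    (F.pair_ext fun u v => (F.pair_comulUc 1 u v).trans (by
      rw [incl_one, Bialgebra.counit_mul]; rfl))
    (fun {f g} => F.pair_ext fun u v => (F.pair_comulUc _ u v).trans (by
      rw [incl_mul, Bialgebra.comul_mul, map_incl_mul]
      exact (F.pair_mul _ _ u v).symm))

open UniversalEnvelopingAlgebra (antipodeLin)

theorem antipode_cof (n : ℕ) {u : UniversalEnvelopingAlgebra k L} (hu : u ∈ cof F.sub n) :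
    antipodeLin u ∈ cof F.sub n := by
  let I : Ideal (UniversalEnvelopingAlgebra k L) :=
    { carrier := {u | (antipodeLin u : UniversalEnvelopingAlgebra k L) ∈ cof F.sub n}
      zero_mem' := by simp
      add_mem' := fun {a b} ha hb => by
        change antipodeLin (a + b) ∈ cof F.sub n; rw [map_add]; exact add_mem ha hb
      smul_mem' := fun c a ha => by
        change antipodeLin (c * a) ∈ cof F.sub n
        rw [UniversalEnvelopingAlgebra.antipodeLin_mul]; exact Ideal.mul_mem_right _ _ ha }
  have : I.IsTwoSided := ⟨fun {a} b ha => by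
    change antipodeLin (a * b) ∈ cof F.sub n
    rw [UniversalEnvelopingAlgebra.antipodeLin_mul]; exact Ideal.mul_mem_left _ _ ha⟩
  have h1 : ∀ u ∈ aug k L, antipodeLin u ∈ aug k L := by
    have h : (Algebra.linearMap k _ ∘ₗ Coalgebra.counit ∘ₗ antipodeLin :
        UniversalEnvelopingAlgebra k L →ₗ[k] UniversalEnvelopingAlgebra k L) =
        Algebra.linearMap k _ ∘ₗ Coalgebra.counit := by
      ext u
      refine UniversalEnvelopingAlgebra.eq_top_of_left (LinearMap.eqLocus _ _) ?_
        (fun x u _ => ?_) u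
      · simp [UniversalEnvelopingAlgebra.antipodeLin_one]
      · simp [UniversalEnvelopingAlgebra.antipodeLin_mul, UniversalEnvelopingAlgebra.counit_ι,
          UniversalEnvelopingAlgebra.antipodeLin_ι, -UniversalEnvelopingAlgebra.ι_apply]
    intro u hu
    rw [UniversalEnvelopingAlgebra.mem_aug] at hu ⊢
    have h2 := congr($h u)
    simp only [LinearMap.comp_apply, hu, map_zero] at h2
    exact Bialgebra.algebraMap_injective (UniversalEnvelopingAlgebra k L) (by simpa using h2)
  have h2 : ∀ n, ∀ u ∈ aug k L ^ n, antipodeLin u ∈ aug k L ^ n := by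
    intro n
    induction n with
    | zero => intro u _; rw [Submodule.pow_zero, Ideal.one_eq_top]; trivial
    | succ n ih =>
      intro u hu
      rw [Submodule.pow_succ] at hu
      refine Submodule.mul_induction_on hu (fun a ha b hb => ?_) fun a b ha hb => ?_
      · rw [UniversalEnvelopingAlgebra.antipodeLin_mul, Ideal.IsTwoSided.pow_succ]
        exact Ideal.mul_mem_mul (h1 b hb) (ih a ha)
      · rw [map_add]; exact add_mem ha hb
  refine (sup_le (fun u hu => ?_) (UniversalEnvelopingAlgebra.gen_le fun x hx => ?_) :
    cof F.sub n ≤ I) hu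
  · exact UniversalEnvelopingAlgebra.aug_pow_le_cof _ _ (h2 n u hu)
  · change antipodeLin (ι k x) ∈ cof F.sub n
    rw [UniversalEnvelopingAlgebra.antipodeLin_ι]
    exact neg_mem (Ideal.mem_sup_right (UniversalEnvelopingAlgebra.ι_mem_gen hx))

/-- The antipode of `U^c(K)`, dual to the antipode of `U(L)`. -/
def antipodeUc : F.Uc →ₗ[k] F.Uc where
  toFun f := ⟨WithConv.toConv (F.incl f ∘ₗ antipodeLin), F.mem_ucSub.2 <| by
    obtain ⟨n, hn⟩ := F.exists_kill f
    exact ⟨n, fun u hu => hn _ (F.antipode_cof n hu)⟩⟩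
  map_add' _ _ := rfl
  map_smul' _ _ := rfl

theorem incl_antipodeUc (f : F.Uc) (u : UniversalEnvelopingAlgebra k L) :
    F.incl (F.antipodeUc f) u = F.incl f (antipodeLin u) := rfl

theorem pair_map {A B : F.Uc →ₗ[k] F.Uc}
    {A' B' : UniversalEnvelopingAlgebra k L →ₗ[k] UniversalEnvelopingAlgebra k L}
    (hA : ∀ f u, F.incl (A f) u = F.incl f (A' u)) (hB : ∀ f u, F.incl (B f) u = F.incl f (B' u))
    (t : F.Uc ⊗[k] F.Uc) (x : UniversalEnvelopingAlgebra k L ⊗[k] UniversalEnvelopingAlgebra k L) :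
    F.pair (TensorProduct.map A B t) x = F.pair t (TensorProduct.map A' B' x) := by
  induction t with
  | zero => simp
  | add a b ha hb => simp only [map_add, LinearMap.add_apply, ha, hb]
  | tmul a b =>
    induction x with
    | zero => simp
    | add x y hx hy => simp only [map_add, hx, hy]
    | tmul x y => simp [pair_tmul, hA, hB]

instance instHopfAlgebra : HopfAlgebra k F.Uc where
  antipode := F.antipodeUc
  mul_antipode_rTensor_comul := by
    ext f : 1
    refine F.ext_incl fun u => ?_
    refine (F.incl_mul' _ u).trans ((F.pair_map F.incl_antipodeUc (B' := LinearMap.id)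
      (fun _ _ => rfl) _ _).trans ((F.pair_comulUc' f _).trans ?_))
    have h := HopfAlgebra.mul_antipode_rTensor_comul_apply (R := k) u
    refine (congrArg (F.incl f) h).trans ?_
    rw [Algebra.algebraMap_eq_smul_one, map_smul, smul_eq_mul, mul_comm]
    change _ = F.incl (algebraMap k F.Uc (F.counitUc f)) u
    rw [Algebra.algebraMap_eq_smul_one, map_smul]; rfl
  mul_antipode_lTensor_comul := by
    ext f : 1
    refine F.ext_incl fun u => ?_
    refine (F.incl_mul' _ u).trans ((F.pair_map (A' := LinearMap.id) (fun _ _ => rfl)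
      F.incl_antipodeUc _ _).trans ((F.pair_comulUc' f _).trans ?_))
    have h := HopfAlgebra.mul_antipode_lTensor_comul_apply (R := k) u
    refine (congrArg (F.incl f) h).trans ?_
    rw [Algebra.algebraMap_eq_smul_one, map_smul, smul_eq_mul, mul_comm]
    change _ = F.incl (algebraMap k F.Uc (F.counitUc f)) u
    rw [Algebra.algebraMap_eq_smul_one, map_smul]; rfl

/-! ### The Euler idempotent and the projection to `K` -/

/-- `J = 1 - η ∘ ε`, in the convolution algebra of endomorphisms of `U^c(K)`. -/
def J : WithConv (F.Uc →ₗ[k] F.Uc) :=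
  WithConv.toConv (LinearMap.id : F.Uc →ₗ[k] F.Uc) - 1

/-- The Euler map `e = log^⋆ 1 = J - J^{⋆2}/2 + J^{⋆3}/3 - ⋯`, a locally finite sum
(see `finite_support_euler`). -/
def euler (f : F.Uc) : F.Uc :=
  ∑ᶠ n : ℕ, ((-1 : k) ^ n / (n + 1)) • (F.J ^ (n + 1)).ofConv f

theorem J_pow_adjoint (n : ℕ) (f : F.Uc) (u : UniversalEnvelopingAlgebra k L) :
    F.incl ((F.J ^ n).ofConv f) u = F.incl f
      (((WithConv.toConv (LinearMap.id : _ →ₗ[k] _) - 1 : WithConv (UniversalEnvelopingAlgebra k L →ₗ[k]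
        UniversalEnvelopingAlgebra k L)) ^ n).ofConv u) := by
  have h1 : ∀ f u, F.incl ((1 : WithConv (F.Uc →ₗ[k] F.Uc)).ofConv f) u =
      F.incl f ((1 : WithConv (UniversalEnvelopingAlgebra k L →ₗ[k]
        UniversalEnvelopingAlgebra k L)).ofConv u) := fun f u => by
    change F.incl (algebraMap k F.Uc (F.counitUc f)) u =
      F.incl f (algebraMap k _ (Coalgebra.counit u))
    rw [Algebra.algebraMap_eq_smul_one, Algebra.algebraMap_eq_smul_one, map_smul, map_smul,
      smul_eq_mul, mul_comm]; rfl
  have hJ : ∀ f u, F.incl (F.J.ofConv f) u = F.incl f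
      ((WithConv.toConv (LinearMap.id : _ →ₗ[k] _) - 1 : WithConv (UniversalEnvelopingAlgebra k L →ₗ[k]
        UniversalEnvelopingAlgebra k L)).ofConv u) := fun f u => by
    change F.incl (f - (1 : WithConv (F.Uc →ₗ[k] F.Uc)).ofConv f) u = F.incl f (u - _)
    rw [map_sub, map_sub, LinearMap.sub_apply, h1]; rfl
  induction n generalizing f u with
  | zero => rw [pow_zero, pow_zero]; exact h1 f u
  | succ n ih =>
    rw [pow_succ, pow_succ]
    exact (F.incl_mul' _ u).trans ((F.pair_map (fun f u => ih f u) hJ _ _).trans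
      (F.pair_comulUc' f _))

theorem J_pow_mem_aug (n : ℕ) (u : UniversalEnvelopingAlgebra k L) :
    ((WithConv.toConv (LinearMap.id : _ →ₗ[k] _) - 1 : WithConv (UniversalEnvelopingAlgebra k L →ₗ[k]
        UniversalEnvelopingAlgebra k L)) ^ n).ofConv u ∈ aug k L ^ n := by
  induction n generalizing u with
  | zero => rw [Submodule.pow_zero, Ideal.one_eq_top]; trivial
  | succ n ih =>
    rw [pow_succ, Submodule.pow_succ]
    change LinearMap.mul' k _ (TensorProduct.map _ _ (Coalgebra.comul u)) ∈ _
    induction Coalgebra.comul (R := k) u with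
    | zero => simp
    | add x y hx hy => simp only [map_add]; exact add_mem hx hy
    | tmul x y =>
      rw [TensorProduct.map_tmul, LinearMap.mul'_apply]
      exact Ideal.mul_mem_mul (ih x) (UniversalEnvelopingAlgebra.sub_counit_mem_aug y)

theorem finite_support_euler (f : F.Uc) :
    (Function.support fun n : ℕ =>
      ((-1 : k) ^ n / (n + 1)) • (F.J ^ (n + 1)).ofConv f).Finite := by
  obtain ⟨m, hm⟩ := F.exists_kill f
  refine (Set.finite_lt_nat m).subset fun n hn => ?_
  by_contra h
  refine hn ?_
  have : (F.J ^ (n + 1)).ofConv f = 0 := F.ext_incl fun u => by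
    rw [J_pow_adjoint, map_zero, LinearMap.zero_apply]
    exact hm _ (UniversalEnvelopingAlgebra.aug_pow_le_cof _ _
      (UniversalEnvelopingAlgebra.aug_pow_anti (by simp at h; omega) (J_pow_mem_aug _ u)))
  simp only [this, smul_zero]

theorem mem_K {κ : Dual k L} : κ ∈ F.kSub ↔ ∃ p, ∀ x ∈ F.sub (p + 1), κ x = 0 := by
  constructor
  · intro hκ
    let S : Submodule k (Dual k L) :=
      { carrier := {κ | ∃ p, ∀ x ∈ F.sub (p + 1), κ x = 0}
        zero_mem' := ⟨0, fun _ _ => rfl⟩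
        smul_mem' := fun c f ⟨n, h⟩ => ⟨n, fun u hu => by
          rw [LinearMap.smul_apply, h u hu, smul_zero]⟩
        add_mem' := fun {f g} ⟨n, hf⟩ ⟨m, hg⟩ => ⟨max n m, fun u hu => by
          rw [LinearMap.add_apply,
            hf u (F.sub_anti (Nat.succ_le_succ (le_max_left n m)) hu),
            hg u (F.sub_anti (Nat.succ_le_succ (le_max_right n m)) hu), add_zero]⟩ }
    refine (iSup_le fun p => ?_ : F.kSub ≤ S) hκ
    rintro _ ⟨g, rfl⟩
    exact ⟨p, fun x hx => (congrArg g (F.quotMap_eq_zero.2 hx)).trans (map_zero g)⟩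
  · rintro ⟨p, h⟩
    refine Submodule.mem_iSup_of_mem p ?_
    rw [LinearMap.range_dualMap_eq_dualAnnihilator_ker]
    exact (Submodule.mem_dualAnnihilator κ).2 fun x hx => h x (F.quotMap_eq_zero.1 hx)

/-- The natural map `U^c(K) → K`, restricting functionals from `U(L)` to `L`. -/
def res : F.Uc →ₗ[k] F.K :=
  LinearMap.codRestrict F.kSub ((ι k : L →ₗ⁅k⁆ _).toLinearMap.dualMap ∘ₗ F.incl) fun f => by
    obtain ⟨n, hn⟩ := F.exists_kill f
    exact F.mem_K.2 ⟨n, fun x hx => hn _ (Ideal.mem_sup_right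
      (UniversalEnvelopingAlgebra.ι_mem_gen (F.sub_anti (Nat.le_succ n) hx)))⟩


/-! ### The completed enveloping algebra -/

/-- `Û(L) = lim U(L) / F^p`. -/
def UHat : Subalgebra k (∀ p, UniversalEnvelopingAlgebra k L ⧸ fil F.sub p) where
  carrier := {x | ∀ p, Ideal.Quotient.factorₐ k
    (UniversalEnvelopingAlgebra.fil_succ_le F.sub F.sub_anti p) (x (p + 1)) = x p}
  mul_mem' {x y} hx hy p := by rw [Pi.mul_apply, Pi.mul_apply, map_mul, hx, hy]
  add_mem' {x y} hx hy p := by rw [Pi.add_apply, Pi.add_apply, map_add, hx, hy]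
  algebraMap_mem' r p := by rw [Pi.algebraMap_apply, Pi.algebraMap_apply, AlgHom.commutes]

/-- The component in `U(L) / F^p`. -/
def component (p : ℕ) : F.UHat →ₐ[k] UniversalEnvelopingAlgebra k L ⧸ fil F.sub p :=
  (Pi.evalAlgHom k _ p).comp F.UHat.val

theorem factor_component (x : F.UHat) (p : ℕ) : Ideal.Quotient.factorₐ k
    (UniversalEnvelopingAlgebra.fil_succ_le F.sub F.sub_anti p) (F.component (p + 1) x) = F.component p x :=
  x.2 p

/-- The augmentation ideal `Û(L)₊`, the kernel of `Û(L) → U(L) / U₊ = k`. -/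
def augHat : Ideal F.UHat := RingHom.ker (F.component 1)

instance instTwoSidedAugHat : F.augHat.IsTwoSided := inferInstanceAs (RingHom.ker _).IsTwoSided

/-- The multiplicative monoid `1 + Û(L)₊`. -/
def oneAdd : Submonoid F.UHat where
  carrier := {x | x - 1 ∈ F.augHat}
  one_mem' := by simp
  mul_mem' {x y} hx hy := by
    have e : x * y - 1 = x * (y - 1) + (x - 1) := by rw [mul_sub, mul_one, sub_add_sub_cancel]
    change x * y - 1 ∈ F.augHat
    rw [e]
    exact add_mem (Ideal.mul_mem_left _ _ hy) hx

theorem component_pow_eq_zero {x : F.UHat} (hx : x ∈ F.augHat) {p n : ℕ} (h : p ≤ n) :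
    F.component p x ^ n = 0 := by
  obtain ⟨u, hu⟩ := Ideal.Quotient.mk_surjective (F.component p x)
  have hmem : ∀ p, p ≠ 0 → ∀ u, Ideal.Quotient.mk _ u = F.component p x → u ∈ aug k L := by
    intro p hp
    induction p, Nat.one_le_iff_ne_zero.2 hp using Nat.le_induction with
    | base =>
      intro u hu
      exact Ideal.Quotient.eq_zero_iff_mem.1 (hu.trans hx)
    | succ p hp' ih =>
      intro u hu
      refine ih (by omega) u ?_
      rw [← factor_component, ← hu]; rfl
  have hpow : ∀ n, ∀ u ∈ aug k L, u ^ n ∈ aug k L ^ n := by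
    intro n u hu
    induction n with
    | zero => rw [Submodule.pow_zero, Ideal.one_eq_top]; trivial
    | succ n ih =>
      rw [_root_.pow_succ, Submodule.pow_succ]
      exact Ideal.mul_mem_mul ih hu
  rw [← hu, ← map_pow, Ideal.Quotient.eq_zero_iff_mem]
  rcases eq_or_ne p 0 with rfl | hp
  · trivial
  · exact UniversalEnvelopingAlgebra.aug_pow_le_fil _ _
      (UniversalEnvelopingAlgebra.aug_pow_anti h (hpow n u (hmem p hp u hu)))

/-- The sum `∑ cₙ xⁿ` in `Û(L)` for `x ∈ Û(L)₊`; the terms with `n ≥ p` vanish modulo `F^p`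
(see `component_pow_eq_zero`). -/
def series (c : ℕ → k) (x : F.augHat) : F.UHat :=
  ⟨fun p => ∑ n ∈ Finset.range p, c n • F.component p x.1 ^ n, fun p => by
    have h : ∀ n, Ideal.Quotient.factorₐ k
        (UniversalEnvelopingAlgebra.fil_succ_le F.sub F.sub_anti p)
        (c n • F.component (p + 1) x.1 ^ n) = c n • F.component p x.1 ^ n := fun n => by
      rw [map_smul, map_pow, factor_component]
    refine (map_sum (Ideal.Quotient.factorₐ k
      (UniversalEnvelopingAlgebra.fil_succ_le F.sub F.sub_anti p)) _ _).trans ?_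
    rw [Finset.sum_congr rfl fun n _ => h n, Finset.sum_range_succ,
      F.component_pow_eq_zero x.2 le_rfl, smul_zero, add_zero]⟩

/-- `exp x = ∑ xⁿ / n!`. -/
def exp (x : F.augHat) : F.oneAdd :=
  ⟨F.series (fun n => (n.factorial : k)⁻¹) x, by
    change F.component 1 (_ - 1) = 0
    rw [map_sub, map_one]
    change ∑ n ∈ Finset.range 1, _ - _ = 0
    simp⟩

/-- `log (1 + s) = s - s²/2 + s³/3 - ⋯`. -/
def log (y : F.oneAdd) : F.augHat :=
  ⟨F.series (fun n => if n = 0 then 0 else (-1) ^ (n + 1) / (n : k)) ⟨y.1 - 1, y.2⟩, by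
    change ∑ n ∈ Finset.range 1, _ = 0
    simp⟩

/-- The natural map `L → Û(L)₊`. -/
def ιHat : L →ₗ[k] F.augHat where
  toFun x := ⟨⟨fun p => Ideal.Quotient.mk _ (ι k x), fun _ => rfl⟩,
    Ideal.Quotient.eq_zero_iff_mem.2 (UniversalEnvelopingAlgebra.ι_mem_aug x)⟩
  map_add' x y := by
    ext p; simp [-UniversalEnvelopingAlgebra.ι_apply]
  map_smul' r x := by
    ext p
    change Ideal.Quotient.mkₐ k (fil F.sub p) (ι k (r • x)) =
      r • Ideal.Quotient.mkₐ k (fil F.sub p) (ι k x)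
    rw [map_smul, map_smul]

/-! ### `L` as the affine space with coordinate functions `K` -/

theorem eval_bijective : Function.Bijective (LinearMap.flip F.kVal) := by
  have hK : ∀ p (g : Dual k (L ⧸ F.ideal (p + 1))), g ∘ₗ (F.quotMap p).toLinearMap ∈ F.kSub :=
    fun p g => Submodule.mem_iSup_of_mem p ⟨g, rfl⟩
  constructor
  · rw [← LinearMap.ker_eq_bot, LinearMap.ker_eq_bot']
    intro a ha
    have h0 : ∀ p, F.quotMap p a = 0 := fun p =>
      (Module.forall_dual_apply_eq_zero_iff k _).1 fun g => congr($ha ⟨_, hK p g⟩)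
    exact (F.complete (fun _ => 0) fun _ => map_zero _).unique h0 fun _ => rfl
  · intro φ
    let r : ∀ p, Dual k (L ⧸ F.ideal (p + 1)) →ₗ[k] F.K := fun p =>
      LinearMap.codRestrict F.kSub (F.quotMap p).toLinearMap.dualMap (hK p)
    let x : ∀ p, L ⧸ F.ideal (p + 1) := fun p =>
      (Module.evalEquiv k (L ⧸ F.ideal (p + 1))).symm (φ ∘ₗ r p)
    have hx : ∀ p g, g (x p) = φ (r p g) := fun p g => by
      have h := (Module.evalEquiv k (L ⧸ F.ideal (p + 1))).apply_symm_apply (φ ∘ₗ r p)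
      exact LinearMap.congr_fun h g
    have hc : ∀ p, Submodule.factor (LieSubmodule.toSubmodule_le_toSubmodule _ _ |>.2
        (F.antitone (Nat.le_succ (p + 1)))) (x (p + 1)) = x p := fun p => by
      let t : (L ⧸ F.ideal (p + 1 + 1)) →ₗ[k] (L ⧸ F.ideal (p + 1)) :=
        Submodule.factor (LieSubmodule.toSubmodule_le_toSubmodule _ _ |>.2
          (F.antitone (Nat.le_succ (p + 1))))
      change t (x (p + 1)) = x p
      have h : ∀ g : Dual k (L ⧸ F.ideal (p + 1)), g (t (x (p + 1)) - x p) = 0 := fun g => by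
        have e : r (p + 1) (g ∘ₗ t) = r p g := Subtype.ext rfl
        rw [map_sub, sub_eq_zero, hx p g, ← e, ← hx (p + 1), LinearMap.comp_apply]
      exact sub_eq_zero.1 ((Module.forall_dual_apply_eq_zero_iff k _).1 h)
    obtain ⟨y, hy, -⟩ := F.complete x hc
    refine ⟨y, LinearMap.ext fun κ => ?_⟩
    obtain ⟨p, hp⟩ := F.mem_K.1 κ.2
    have hκ : κ.1 ∈ LinearMap.range (F.quotMap p).toLinearMap.dualMap := by
      rw [LinearMap.range_dualMap_eq_dualAnnihilator_ker]
      exact (Submodule.mem_dualAnnihilator _).2 fun x hx => hp x (F.quotMap_eq_zero.1 hx)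
    obtain ⟨g, hg⟩ := hκ
    have e : κ = r p g := Subtype.ext hg.symm
    rw [e, ← hx p g, ← hy p]
    rfl

/-- The isomorphism `L ≅ Hom(K, k)`, `a ↦ (κ ↦ κ(a))`. -/
def dualEquiv : L ≃ₗ[k] Dual k F.K :=
  LinearEquiv.ofBijective (LinearMap.flip F.kVal) F.eval_bijective

theorem dualEquiv_apply (a : L) (κ : F.K) : F.dualEquiv a κ = F.kVal κ a := rfl

/-- The isomorphism `L × L ≅ Hom(K ⊕ K, k)`, `(a, b) ↦ ((κ, κ') ↦ κ(a) + κ'(b))`. -/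
def prodDualEquiv : (L × L) ≃ₗ[k] Dual k (F.K × F.K) :=
  (F.dualEquiv.prodCongr F.dualEquiv).trans (Module.dualProdDualEquivDual k F.K F.K)

theorem prodDualEquiv_apply (a b : L) (κ κ' : F.K) :
    F.prodDualEquiv (a, b) (κ, κ') = F.kVal κ a + F.kVal κ' b := rfl

end CompleteLieFiltration

/-! ### Affine spaces and their morphisms

An affine space is given as a vector space `V` together with an isomorphism `V ≅ Hom(W, k)`. Its
coordinate ring is `Sym(W)`. -/

namespace AffineSpace

open Module (Dual)

variable {k : Type*} [Field k]

/-- Evaluation of a polynomial function at a point. -/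
def ev {W : Type*} [AddCommGroup W] [Module k W] (v : Dual k W) : SymmetricAlgebra k W →ₐ[k] k :=
  SymmetricAlgebra.lift v

/-- An exhaustive filtration `0 = W₀ ⊆ W₁ ⊆ ⋯ ⊆ W` by finite-dimensional subspaces. It
corresponds to the decreasing filtration of `V = Hom(W, k)` by the kernels `V^{i+1}` of
`V → Hom(Wᵢ, k)`, with finite-dimensional quotients `V / V^{i+1} ≅ Hom(Wᵢ, k)`. -/
structure Filtration (k W : Type*) [Field k] [AddCommGroup W] [Module k W] where
  sub : ℕ → Submodule k W
  zero_eq_bot : sub 0 = ⊥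
  mono : Monotone sub
  finite : ∀ i, FiniteDimensional k (sub i)
  exhaustive : ⨆ i, sub i = ⊤

/-- Maps of (finite-dimensional) affine spaces whose coordinates are polynomials. -/
def IsPolynomial {A B : Type*} [AddCommGroup A] [Module k A] [AddCommGroup B] [Module k B]
    (g : Dual k A → Dual k B) : Prop :=
  ∀ b : B, ∃ s : SymmetricAlgebra k A, ∀ x, g x b = ev x s

variable {V₁ V₂ W₁ W₂ : Type*} [AddCommGroup V₁] [Module k V₁] [AddCommGroup V₂] [Module k V₂]
  [AddCommGroup W₁] [Module k W₁] [AddCommGroup W₂] [Module k W₂]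

/-- A map `f : V₁ → V₂` is a morphism of varieties if there are filtrations such that `f` descends,
for each `i`, to a polynomial map `V₁ / V₁ⁱ → V₂ / V₂ⁱ`. -/
def IsMorphism (e₁ : V₁ ≃ₗ[k] Dual k W₁) (e₂ : V₂ ≃ₗ[k] Dual k W₂) (f : V₁ → V₂) : Prop :=
  ∃ (A : Filtration k W₁) (B : Filtration k W₂), ∀ i,
    ∃ g : Dual k (A.sub i) → Dual k (B.sub i), IsPolynomial g ∧
      ∀ v, (e₂ (f v)).domRestrict (B.sub i) = g ((e₁ v).domRestrict (A.sub i))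

/-- `φ : Sym(W₂) → Sym(W₁)` is the homomorphism of coordinate rings corresponding to `f`, that is,
pullback of functions along `f`. -/
def IsComorphism (e₁ : V₁ ≃ₗ[k] Dual k W₁) (e₂ : V₂ ≃ₗ[k] Dual k W₂) (f : V₁ → V₂)
    (φ : SymmetricAlgebra k W₂ →ₐ[k] SymmetricAlgebra k W₁) : Prop :=
  ∀ v s, ev (e₁ v) (φ s) = ev (e₂ (f v)) s

/-- The identification `Sym(W₁ ⊕ W₂) ≅ Sym(W₁) ⊗ Sym(W₂)` of the coordinate ring of a product. -/
def symProd (k W₁ W₂ : Type*) [Field k] [AddCommGroup W₁] [Module k W₁] [AddCommGroup W₂]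
    [Module k W₂] : SymmetricAlgebra k (W₁ × W₂) ≃ₐ[k]
      SymmetricAlgebra k W₁ ⊗[k] SymmetricAlgebra k W₂ :=
  AlgEquiv.ofAlgHom
    (SymmetricAlgebra.lift (LinearMap.coprod
      (Algebra.TensorProduct.includeLeft.toLinearMap ∘ₗ SymmetricAlgebra.ι k W₁)
      (Algebra.TensorProduct.includeRight.toLinearMap ∘ₗ SymmetricAlgebra.ι k W₂)))
    (Algebra.TensorProduct.lift
      (SymmetricAlgebra.lift (SymmetricAlgebra.ι k (W₁ × W₂) ∘ₗ LinearMap.inl k W₁ W₂))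
      (SymmetricAlgebra.lift (SymmetricAlgebra.ι k (W₁ × W₂) ∘ₗ LinearMap.inr k W₁ W₂))
      fun _ _ => Commute.all _ _)
    (by ext w <;> simp)
    (by ext w <;> simp)

theorem symProd_ι (w₁ : W₁) (w₂ : W₂) : symProd k W₁ W₂ (SymmetricAlgebra.ι k _ (w₁, w₂)) =
    SymmetricAlgebra.ι k W₁ w₁ ⊗ₜ 1 + 1 ⊗ₜ SymmetricAlgebra.ι k W₂ w₂ := by
  simp [symProd]

end AffineSpace
end

/-! For `a` in `L` the exponential of `a` is group-like, and every `f` in `U^c(K)` kills a power of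
the augmentation ideal, so `f ↦ ⟨f, exp a⟩` is a well-defined character `expChar a` of `U^c(K)`. The
proof identifies `f` with the function `a ↦ ⟨f, exp a⟩` on `L`. These functions determine `f`
(`ext_expChar`): in characteristic zero the powers `a^n` span `U(L)` (`span_pow_ι`, by
polarisation), and rescaling `a` recovers each `f(a^n)`. They are polynomial
(`exists_ev_eq_expChar`), since `f` sees only finitely many coordinates of `a`. The convolution
power `J^m` multiplies `a^n` by `n!` times the `n`-th coefficient of `(exp X - 1)^m`, so `log (exp
X) = X` shows that `e(f)` agrees with `f` on `a` and vanishes on all other powers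
(`incl_euler_pow`). Hence `⟨e(f), exp a⟩ = f(a)`, and the algebra map `ψ` extending the Euler
section satisfies `⟨ψ(s), exp a⟩ = s(a)`. It is injective because polynomials over an infinite field
are functions, and surjective because all the functions of `U^c(K)` are polynomial. The Euler
section exists on all of `K` only if `res` is onto. This needs the nilpotent algebra `L_p` to embed
in a quotient of `U(L_p)` by a power of the augmentation ideal. That is Birkhoff's argument
(`exists_pow_aug_inf_eq_zero`), an induction over ideals of codimension one that does not use the
Poincaré-Birkhoff-Witt theorem. For the group law, the coproduct is transported by `ψ` to a map `φ`
of symmetric algebras. Evaluating `φ` at `(a, b)` gives a character of `Sym(K)`, that is, a point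
`μ(a, b)` of `L`. Then `exp (μ(a, b))` and `exp a • exp b` pair equally with all of `U^c(K)`, which
separates the points of every `U(L)/F^p`, so they are equal in `Û(L)`. Thus the logarithm of the
product lies in `L` without any explicit Baker-Campbell-Hausdorff series or criterion for primitive
elements. -/

noncomputable section

attribute [local instance 100] LieRing.ofAssociativeRing

namespace UniversalEnvelopingAlgebra

/-! ### Extension of derivations from a Lie algebra to its enveloping algebra. -/

section Derivation

variable {k : Type*} [Field k] {L : Type*} [LieRing L] [LieAlgebra k L]

/-- Two maps satisfying the Leibniz rule are equal if they agree on the Lie algebra. -/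
theorem leibniz_ext {D E : UniversalEnvelopingAlgebra k L →ₗ[k] UniversalEnvelopingAlgebra k L}
    (hD : ∀ u v, D (u * v) = D u * v + u * D v) (hE : ∀ u v, E (u * v) = E u * v + u * E v)
    (h : ∀ x, D (ι k x) = E (ι k x)) : D = E := by
  have one : ∀ {D : UniversalEnvelopingAlgebra k L →ₗ[k] UniversalEnvelopingAlgebra k L},
      (∀ u v, D (u * v) = D u * v + u * D v) → D 1 = 0 := fun {D} hD => by
    have := hD 1 1
    simpa using this
  refine LinearMap.ext fun u => eq_top_of_left (LinearMap.eqLocus D E) ?_ (fun x u hu => ?_) u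
  · rw [LinearMap.mem_eqLocus, one hD, one hE]
  · rw [LinearMap.mem_eqLocus] at hu ⊢
    rw [hD, hE, hu, h]

/-- The algebra map `u ↦ u + ε D(u)` for the extension of a derivation `D` to `U(L)`. -/
def derivationHom (D : LieDerivation k L L) : UniversalEnvelopingAlgebra k L →ₐ[k]
    TrivSqZeroExt (UniversalEnvelopingAlgebra k L) (UniversalEnvelopingAlgebra k L) :=
  lift k
    { toFun := fun x => TrivSqZeroExt.inl (ι k x) + TrivSqZeroExt.inr (ι k (D x))
      map_add' := fun x y => by
        simp only [map_add, TrivSqZeroExt.inl_add, TrivSqZeroExt.inr_add]; abel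
      map_smul' := fun r x => by
        simp only [map_smul, TrivSqZeroExt.inl_smul, TrivSqZeroExt.inr_smul, smul_add,
          RingHom.id_apply]
      map_lie' := fun {x y} => by
        ext
        · simp [LieRing.of_associative_ring_bracket, -ι_apply]
        · simp [LieRing.of_associative_ring_bracket, -ι_apply]
          abel }

theorem fst_derivationHom (D : LieDerivation k L L) (u : UniversalEnvelopingAlgebra k L) :
    (derivationHom D u).fst = u := by
  have h : (TrivSqZeroExt.fstHom k _ _).comp (derivationHom D) = AlgHom.id k _ :=
    hom_ext_ι fun x => by
      rw [AlgHom.comp_apply, derivationHom, lift_ι_apply]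
      simp [-ι_apply]
  exact congr($h u)

/-- The extension of a derivation of `L` to a derivation of `U(L)`. -/
def extendDerivation (D : LieDerivation k L L) :
    UniversalEnvelopingAlgebra k L →ₗ[k] UniversalEnvelopingAlgebra k L where
  toFun u := (derivationHom D u).snd
  map_add' u v := by rw [map_add, TrivSqZeroExt.snd_add]
  map_smul' r u := by rw [map_smul, TrivSqZeroExt.snd_smul]; rfl

theorem extendDerivation_ι (D : LieDerivation k L L) (x : L) :
    extendDerivation D (ι k x) = ι k (D x) := by
  change (derivationHom D (ι k x)).snd = _
  rw [derivationHom, lift_ι_apply]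
  simp [-ι_apply]

theorem extendDerivation_mul (D : LieDerivation k L L) (u v : UniversalEnvelopingAlgebra k L) :
    extendDerivation D (u * v) = extendDerivation D u * v + u * extendDerivation D v := by
  change (derivationHom D (u * v)).snd =
    (derivationHom D u).snd * v + u * (derivationHom D v).snd
  rw [map_mul, TrivSqZeroExt.snd_mul, fst_derivationHom, fst_derivationHom, add_comm]
  rfl

theorem extendDerivation_one (D : LieDerivation k L L) :
    extendDerivation D (1 : UniversalEnvelopingAlgebra k L) = 0 := by
  have := extendDerivation_mul D 1 1
  simpa using this

end Derivation

/-! ### Weights of words in a filtered Lie algebra. -/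

section Weight

variable {k : Type*} [Field k] {L : Type*} [LieRing L] [LieAlgebra k L]

/-- The span of the products of elements of `L` of total weight at least `w`, the elements of
`H i` having weight `i`. -/
def weight (H : ℕ → Submodule k L) (w : ℕ) : Submodule k (UniversalEnvelopingAlgebra k L) :=
  Submodule.span k {u | ∃ l : List (ℕ × L), (∀ p ∈ l, p.2 ∈ H p.1) ∧
    w ≤ (l.map Prod.fst).sum ∧ u = (l.map fun p => ι k p.2).prod}

variable {H : ℕ → Submodule k L}

theorem one_mem_weight : (1 : UniversalEnvelopingAlgebra k L) ∈ weight H 0 :=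
  Submodule.subset_span ⟨[], by simp, by simp, by simp⟩

theorem weight_anti : Antitone (weight H) := fun _ _ h =>
  Submodule.span_mono fun _ ⟨l, h1, h2, h3⟩ => ⟨l, h1, h.trans h2, h3⟩

theorem ι_mul_mem_weight {i w : ℕ} {x : L} (hx : x ∈ H i) {u : UniversalEnvelopingAlgebra k L}
    (hu : u ∈ weight H w) : ι k x * u ∈ weight H (w + i) := by
  refine (Submodule.span_le.2 ?_ : weight H w ≤ (weight H (w + i)).comap
    (LinearMap.mulLeft k (ι k x))) hu
  rintro _ ⟨l, h1, h2, rfl⟩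
  exact Submodule.subset_span ⟨(i, x) :: l, by simpa using ⟨hx, fun a b h => h1 _ h⟩,
    by simp; omega, by simp [-ι_apply]⟩

theorem mul_ι_mem_weight {i w : ℕ} {x : L} (hx : x ∈ H i) {u : UniversalEnvelopingAlgebra k L}
    (hu : u ∈ weight H w) : u * ι k x ∈ weight H (w + i) := by
  refine (Submodule.span_le.2 ?_ : weight H w ≤ (weight H (w + i)).comap
    (LinearMap.mulRight k (ι k x))) hu
  rintro _ ⟨l, h1, h2, rfl⟩
  refine Submodule.subset_span ⟨l ++ [(i, x)], fun p hp => ?_, by simp; omega,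
    by simp [-ι_apply]⟩
  rcases List.mem_append.1 hp with h | h
  · exact h1 p h
  · rw [List.mem_singleton.1 h]; exact hx

theorem extendDerivation_mem_weight {D : LieDerivation k L L}
    (hD : ∀ i, ∀ x ∈ H i, D x ∈ H (i + 1)) {w : ℕ} {u : UniversalEnvelopingAlgebra k L}
    (hu : u ∈ weight H w) : extendDerivation D u ∈ weight H (w + 1) := by
  refine (Submodule.span_le.2 ?_ : weight H w ≤ (weight H (w + 1)).comap
    (extendDerivation D)) hu
  rintro _ ⟨l, h1, h2, rfl⟩
  -- The bound `w` is replaced by the exact weight of the word, so that induction on the word is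
  -- possible.
  refine weight_anti (Nat.succ_le_succ h2) ?_
  clear h2 hu
  induction l with
  | nil => simp [extendDerivation_one]
  | cons p l ih =>
    have h3 : (l.map fun p => ι k p.2).prod ∈ weight H (l.map Prod.fst).sum :=
      Submodule.subset_span ⟨l, fun p hp => h1 p (List.mem_cons_of_mem _ hp), le_rfl, rfl⟩
    have h4 := ih fun p hp => h1 p (List.mem_cons_of_mem _ hp)
    have hp := h1 p List.mem_cons_self
    simp only [List.map_cons, List.prod_cons, List.sum_cons, extendDerivation_mul,
      extendDerivation_ι]
    refine add_mem (weight_anti ?_ (ι_mul_mem_weight (hD _ _ hp) h3))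
      (weight_anti ?_ (ι_mul_mem_weight hp h4)) <;> omega

/-- Letters of weight above `c` are zero, so a nonzero word with `l` letters has weight at most `l *
c`. A weight exceeding `n * c` therefore forces at least `n` letters, each lying in the augmentation
ideal. -/
theorem weight_le_aug_pow {c : ℕ} (hH : Antitone H) (hc : H (c + 1) = ⊥) (n : ℕ) :
    weight H (n * c + 1) ≤ (aug k L ^ n).restrictScalars k := by
  refine Submodule.span_le.2 ?_
  rintro _ ⟨l, h1, h2, rfl⟩
  have key : (l.map fun p => ι k p.2).prod ∈ aug k L ^ l.length ∧
      ((l.map fun p => ι k p.2).prod = 0 ∨ (l.map Prod.fst).sum ≤ l.length * c) := by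
    clear h2
    induction l with
    | nil => exact ⟨by rw [List.length_nil, Submodule.pow_zero, Ideal.one_eq_top]; trivial, by simp⟩
    | cons p l ih =>
      obtain ⟨h3, h4⟩ := ih fun p hp => h1 p (List.mem_cons_of_mem _ hp)
      have hp := h1 p List.mem_cons_self
      simp only [List.map_cons, List.prod_cons, List.sum_cons, List.length_cons]
      refine ⟨?_, ?_⟩
      · rw [Ideal.IsTwoSided.pow_succ]
        exact Ideal.mul_mem_mul (ι_mem_aug _) h3
      · rcases h4 with h4 | h4
        · left; rw [h4, mul_zero]
        · by_cases hpc : p.1 ≤ c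
          · right
            rw [add_mul, one_mul]; omega
          · left
            have : p.2 ∈ H (c + 1) := hH (by omega) hp
            rw [hc, Submodule.mem_bot] at this
            rw [this, map_zero, zero_mul]
  rcases key with ⟨h3, h4 | h4⟩
  · rw [h4]; exact zero_mem _
  · refine aug_pow_anti ?_ h3
    by_contra hlt
    have := Nat.mul_le_mul_right c (Nat.le_of_lt (not_le.1 hlt))
    omega

/-- A representation of `L` raising a filtration maps `U₊ⁿ` to operators of degree `n`. -/
theorem lift_mem_of_mem_aug_pow {V : Type*} [AddCommGroup V] [Module k V] {W : ℕ → Submodule k V}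
    (hW : Antitone W) {ρ : L →ₗ⁅k⁆ Module.End k V} (hρ : ∀ x w, ∀ v ∈ W w, ρ x v ∈ W (w + 1))
    {n : ℕ} {u : UniversalEnvelopingAlgebra k L} (hu : u ∈ aug k L ^ n) {w : ℕ} {v : V}
    (hv : v ∈ W w) : lift k ρ u v ∈ W (w + n) := by
  -- These are the `u` that act as the scalar `ε(u)` up to one step of the filtration. They contain
  -- `1` and are stable under left multiplication by `L`, hence are everything; so elements of the
  -- augmentation ideal raise the filtration by one.
  let M : Submodule k (UniversalEnvelopingAlgebra k L) :=
    { carrier := {u | ∀ w, ∀ v ∈ W w, lift k ρ u v - Coalgebra.counit (R := k) u • v ∈ W (w + 1)}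
      zero_mem' := fun w v _ => by simp
      add_mem' := fun {a b} ha hb w v hv => by
        rw [map_add, map_add, LinearMap.add_apply, add_smul, add_sub_add_comm]
        exact add_mem (ha w v hv) (hb w v hv)
      smul_mem' := fun r a ha w v hv => by
        rw [map_smul, map_smul, LinearMap.smul_apply, smul_assoc, ← smul_sub]
        exact Submodule.smul_mem _ _ (ha w v hv) }
  have hM : ∀ u, u ∈ M := eq_top_of_left M (fun w v _ => by simp) fun x u hu w v hv => by
    rw [map_mul, Bialgebra.counit_mul, counit_ι, zero_mul, zero_smul, sub_zero, lift_ι_apply,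
      Module.End.mul_apply]
    refine hρ x w _ ?_
    have := add_mem (hW (Nat.le_succ w) (hu w v hv))
      (Submodule.smul_mem _ (Coalgebra.counit (R := k) u) hv)
    rwa [sub_add_cancel] at this
  induction n generalizing u v w with
  | zero =>
    have := add_mem (hW (Nat.le_succ w) (hM u w v hv))
      (Submodule.smul_mem _ (Coalgebra.counit (R := k) u) hv)
    rwa [sub_add_cancel] at this
  | succ n ih =>
    rw [Submodule.pow_succ] at hu
    refine Submodule.mul_induction_on hu (fun a ha b hb => ?_) fun a b ha hb => ?_
    · rw [map_mul, Module.End.mul_apply]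
      have h1 := hM b w v hv
      rw [mem_aug.1 hb, zero_smul, sub_zero] at h1
      have := ih ha h1
      rwa [show w + 1 + n = w + (n + 1) by omega] at this
    · rw [map_add, LinearMap.add_apply]; exact add_mem ha hb

end Weight

end UniversalEnvelopingAlgebra

namespace UniversalEnvelopingAlgebra

/-! ### The representation of `L` on the enveloping algebra of an ideal. -/

section HyperplaneRep

variable {k : Type*} [Field k] {L : Type*} [LieRing L] [LieAlgebra k L]

/-- The derivation `[a, ·]` of a Lie ideal. -/
def adIdeal (I : LieIdeal k L) (a : L) : LieDerivation k I I where
  toLinearMap := LieModule.toEnd k L I a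
  leibniz' x y := by
    ext
    simp only [LieModule.toEnd_apply_apply, LieSubmodule.coe_bracket, AddSubgroupClass.coe_sub,
      LieIdeal.coe_bracket_of_module]
    rw [leibniz_lie a, ← lie_skew (y : L)]
    abel

theorem coe_adIdeal (I : LieIdeal k L) (a : L) (y : I) : (adIdeal I a y : L) = ⁅a, (y : L)⁆ := rfl

/-- For an ideal `I` and a linear projection `π` of `L` onto `I` along an abelian subalgebra
`ker π`, the representation of `L` on `U(I)` in which `a` acts by the derivation extending `[a, ·]`
plus right multiplication by `π a`. -/
def idealRep (I : LieIdeal k L) (π : L →ₗ[k] I)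
    (hπ : ∀ a b, (π ⁅a, b⁆ : L) = ⁅a, (π b : L)⁆ + ⁅(π a : L), b⁆ - ⁅(π a : L), (π b : L)⁆) :
    L →ₗ⁅k⁆ Module.End k (UniversalEnvelopingAlgebra k I) where
  toFun a := extendDerivation (adIdeal I a) + LinearMap.mulRight k (ι k (π a))
  map_add' a b := by
    -- Linearity in `a` and compatibility with brackets hold for the derivations of `I`. They pass
    -- to the extensions because a derivation of `U(I)` is determined on `I`.
    have h : extendDerivation (adIdeal I (a + b)) =
        extendDerivation (adIdeal I a) + extendDerivation (adIdeal I b) := by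
      refine leibniz_ext (extendDerivation_mul _) (fun u v => ?_) fun x => ?_
      · simp only [LinearMap.add_apply, extendDerivation_mul, add_mul, mul_add]; abel
      · simp only [LinearMap.add_apply, extendDerivation_ι, ← map_add]
        congr 1; ext; simp [coe_adIdeal]
    rw [h, map_add, map_add]
    ext u
    simp only [LinearMap.add_apply, LinearMap.mulRight_apply, mul_add]; abel
  map_smul' r a := by
    have h : extendDerivation (adIdeal I (r • a)) = r • extendDerivation (adIdeal I a) := by
      refine leibniz_ext (extendDerivation_mul _) (fun u v => ?_) fun x => ?_
      · simp only [LinearMap.smul_apply, extendDerivation_mul, smul_add, smul_mul_assoc,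
          mul_smul_comm]
      · simp only [LinearMap.smul_apply, extendDerivation_ι, ← map_smul]
        congr 1; ext; simp [coe_adIdeal]
    rw [h, map_smul, map_smul]
    ext u
    simp
  map_lie' := fun {a b} => by
    have h : extendDerivation (adIdeal I ⁅a, b⁆) =
        extendDerivation (adIdeal I a) * extendDerivation (adIdeal I b) -
          extendDerivation (adIdeal I b) * extendDerivation (adIdeal I a) := by
      refine leibniz_ext (extendDerivation_mul _) (fun u v => ?_) fun x => ?_
      · simp only [LinearMap.sub_apply, Module.End.mul_apply, extendDerivation_mul, map_add]
        noncomm_ring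
      · simp only [LinearMap.sub_apply, Module.End.mul_apply, extendDerivation_ι, ← map_sub]
        congr 1; ext; simp [coe_adIdeal]
    -- Right multiplication reverses commutators, so the commutator of the two operators is the
    -- derivation of `⁅a, b⁆` plus right multiplication by the right-hand side here. The hypothesis
    -- `hπ`, which says that `id - π` preserves brackets, identifies that element with `π ⁅a, b⁆`.
    -- When `ker π` is spanned by `x`, this models the action of `L` on `U(L)/U(L)x`.
    have h2 : π ⁅a, b⁆ = adIdeal I a (π b) - adIdeal I b (π a) - ⁅π a, π b⁆ := by
      ext
      rw [hπ]
      simp only [AddSubgroupClass.coe_sub, coe_adIdeal, LieSubmodule.coe_bracket,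
        LieIdeal.coe_bracket_of_module]
      rw [← lie_skew b]
      abel
    ext u
    simp only [h, h2, LieRing.of_associative_ring_bracket, LinearMap.sub_apply,
      LinearMap.add_apply, Module.End.mul_apply, LinearMap.mulRight_apply, extendDerivation_mul,
      extendDerivation_ι, map_sub, map_add, LieHom.map_lie, mul_sub]
    noncomm_ring

theorem idealRep_one (I : LieIdeal k L) (π : L →ₗ[k] I)
    (hπ : ∀ a b, (π ⁅a, b⁆ : L) = ⁅a, (π b : L)⁆ + ⁅(π a : L), b⁆ - ⁅(π a : L), (π b : L)⁆)
    (a : L) : idealRep I π hπ a 1 = ι k (π a) := by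
  change extendDerivation (adIdeal I a) 1 + 1 * ι k (π a) = _
  rw [extendDerivation_one, zero_add, one_mul]

/-- A linear form vanishing on brackets vanishes on `L ∩ U₊²`. -/
theorem apply_eq_zero_of_mem_aug_sq (χ : L →ₗ[k] k) (hχ : ∀ a b : L, χ ⁅a, b⁆ = 0) {a : L}
    (ha : ι k a ∈ aug k L ^ 2) : χ a = 0 := by
  -- As `χ` kills brackets, `a ↦ χ(a) ε` is a Lie map into the commutative dual numbers. The
  -- augmentation ideal goes into `(ε)`, so its square goes to `0`.
  let f : L →ₗ⁅k⁆ TrivSqZeroExt k k :=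
    { toFun := fun a => TrivSqZeroExt.inr (χ a)
      map_add' := fun a b => by rw [map_add, TrivSqZeroExt.inr_add]
      map_smul' := fun r a => by rw [map_smul, TrivSqZeroExt.inr_smul]; rfl
      map_lie' := fun {a b} => by
        rw [hχ, LieRing.of_associative_ring_bracket, TrivSqZeroExt.inr_mul_inr,
          TrivSqZeroExt.inr_mul_inr, sub_self, TrivSqZeroExt.inr_zero] }
  have h1 : ∀ u, (lift k f u).fst = Coalgebra.counit (R := k) u := fun u => by
    have h : (TrivSqZeroExt.fstHom k _ _).comp (lift k f) = Bialgebra.counitAlgHom k _ :=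
      hom_ext_ι fun x => by
        rw [AlgHom.comp_apply, lift_ι_apply]
        exact (counit_ι x).symm
    exact congr($h u)
  have h2 : ∀ u ∈ aug k L ^ 2, lift k f u = 0 := fun u hu => by
    rw [Submodule.pow_succ, Submodule.pow_one] at hu
    refine Submodule.mul_induction_on hu (fun a ha b hb => ?_) fun a b ha hb => ?_
    · have ha' := h1 a
      have hb' := h1 b
      rw [mem_aug.1 ha] at ha'
      rw [mem_aug.1 hb] at hb'
      rw [map_mul]
      ext
      · simp [ha']
      · simp [ha', hb']
    · rw [map_add, ha, hb, add_zero]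
  have h3 := congrArg TrivSqZeroExt.snd (h2 _ ha)
  rw [lift_ι_apply] at h3
  exact h3

end HyperplaneRep

/-! ### Birkhoff's embedding for nilpotent Lie algebras. -/

section Birkhoff

variable {k : Type*} [Field k]

/-- A finite-dimensional nilpotent Lie algebra meets a high power of the augmentation ideal of its
enveloping algebra only in `0`. -/
theorem exists_pow_aug_inf_eq_zero (d : ℕ) : ∀ {L : Type*} [LieRing L] [LieAlgebra k L]
    [FiniteDimensional k L] (_ : Module.finrank k L = d) (G : ℕ → Submodule k L) (_ : Antitone G)
    (_ : G 1 = ⊤) (_ : ∀ i, ∀ x : L, ∀ y ∈ G i, ⁅x, y⁆ ∈ G (i + 1)) (c : ℕ) (_ : G (c + 1) = ⊥),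
    ∃ n, ∀ a : L, ι k a ∈ aug k L ^ n → a = 0 := by
  induction d with
  | zero =>
    intro L _ _ _ hd G _ _ _ c _
    have := Module.finrank_zero_iff.1 hd
    exact ⟨0, fun a _ => Subsingleton.elim _ _⟩
  | succ d ih =>
    intro L _ _ _ hd G hG h1 hlie c hc
    have hnt : (⊤ : Submodule k L) ≠ ⊥ := fun h => by
      have := finrank_top k L
      rw [h, finrank_bot] at this
      omega
    -- At the last index where `G i` is still everything, all brackets lie in the proper subspace `G
    -- (i + 1)`. A nonzero form `χ` vanishing there kills brackets, so its kernel is an ideal of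
    -- codimension one.
    obtain ⟨i, hi, hi'⟩ : ∃ i, G i = ⊤ ∧ G (i + 1) ≠ ⊤ := by
      by_contra! h
      have : ∀ i, G (i + 1) = ⊤ := fun i => by
        induction i with
        | zero => exact h1
        | succ i ih => exact h _ ih
      exact hnt ((this c).symm.trans hc)
    obtain ⟨χ, hχ0, hχ⟩ := Submodule.exists_le_ker_of_lt_top _ (lt_top_iff_ne_top.2 hi')
    have hχlie : ∀ a b, χ ⁅a, b⁆ = 0 := fun a b => hχ (hlie i a b (hi ▸ trivial))
    let I : LieIdeal k L :=
      { LinearMap.ker χ with lie_mem := fun {a b} _ => hχlie a b }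
    obtain ⟨x, hx⟩ : ∃ x, χ x = 1 := LinearMap.surjective hχ0 1
    let π : L →ₗ[k] I :=
      LinearMap.codRestrict (LinearMap.ker χ) (LinearMap.id - χ.smulRight x) fun a => by
        simp [hx]
    have hπa : ∀ a, (π a : L) = a - χ a • x := fun a => rfl
    -- The projection along `x` leaves the complement spanned by `x`, which is abelian, and `χ` is
    -- zero on brackets.
    have hπ : ∀ a b, (π ⁅a, b⁆ : L) =
        ⁅a, (π b : L)⁆ + ⁅(π a : L), b⁆ - ⁅(π a : L), (π b : L)⁆ := fun a b => by
      simp only [hπa, hχlie, zero_smul, sub_zero, lie_sub, sub_lie, lie_smul, smul_lie, lie_self,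
        smul_zero]
      abel
    have hI : Module.finrank k I = d := by
      have := Module.Dual.finrank_ker_add_one_of_ne_zero (f := χ) hχ0
      change Module.finrank k (LinearMap.ker χ) = d
      omega
    obtain ⟨n, hn⟩ := ih (L := I) hI (fun i => (G i).comap (LinearMap.ker χ).subtype)
      (fun _ _ h => Submodule.comap_mono (hG h)) (by rw [h1]; rfl)
      (fun i x y hy => hlie i x y hy) c (by
        rw [hc]; exact LinearMap.ker_eq_bot.2 (Submodule.injective_subtype _))
    set H : ℕ → Submodule k I := fun i => (G i).comap (LinearMap.ker χ).subtype with hHdef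
    -- Both summands of the operator raise weights: the derivation because bracketing with `a` moves
    -- `G i` into `G (i + 1)`, the right multiplication because every element of `I` has weight at
    -- least one.
    have hρ : ∀ a w, ∀ v ∈ weight H w, idealRep I π hπ a v ∈ weight H (w + 1) := fun a w v hv =>
      add_mem (extendDerivation_mem_weight (H := H) (D := adIdeal I a) (fun i y hy => hlie i a y hy) hv)
        (mul_ι_mem_weight (show π a ∈ H 1 from show (π a : L) ∈ G 1 by rw [h1]; trivial) hv)
    -- The exponent `2` forces `χ a = 0`, hence `π a = a`. The exponent `n * c + 1` puts the image
    -- of `1` under `a`, which is `π a`, into the `n`-th power of the augmentation ideal of `U(I)`,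
    -- where the induction hypothesis applies.
    refine ⟨max 2 (n * c + 1), fun a ha => ?_⟩
    have hχa : χ a = 0 := apply_eq_zero_of_mem_aug_sq χ hχlie (aug_pow_anti (le_max_left _ _) ha)
    have h := lift_mem_of_mem_aug_pow weight_anti hρ (aug_pow_anti (le_max_right _ _) ha)
      one_mem_weight
    rw [lift_ι_apply, idealRep_one, zero_add] at h
    have h2 := congrArg (Subtype.val) (hn _ (weight_le_aug_pow (fun _ _ h =>
      Submodule.comap_mono (hG h)) (by
        rw [hc]; exact LinearMap.ker_eq_bot.2 (Submodule.injective_subtype _)) n h))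
    rw [hπa, hχa, zero_smul, sub_zero] at h2
    exact h2

end Birkhoff

end UniversalEnvelopingAlgebra

/-! ### Polarisation, and the span of the powers in `U(L)`. -/

section PowerExpansion

/-- If all values of a polynomial with coefficients in a vector space over an infinite field lie in
a subspace, then so do its coefficients. -/
theorem Submodule.mem_of_forall_sum_pow_smul_mem {k V : Type*} [Field k] [Infinite k]
    [AddCommGroup V] [Module k V] (S : Submodule k V) {N : ℕ} {v : ℕ → V}
    (h : ∀ t : k, ∑ j ∈ Finset.range N, t ^ j • v j ∈ S) {j : ℕ} (hj : j < N) : v j ∈ S := by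
  by_contra hv
  -- A form that vanishes on `S` but not on `v j` reduces the claim to a scalar polynomial with
  -- infinitely many zeros.
  obtain ⟨f, hf, hS⟩ := Submodule.exists_le_ker_of_notMem hv
  let P : Polynomial k := ∑ j ∈ Finset.range N, Polynomial.monomial j (f (v j))
  have hP : P = 0 := Polynomial.funext fun t => by
    have h1 : f (∑ j ∈ Finset.range N, t ^ j • v j) = 0 := hS (h t)
    rw [map_sum] at h1
    simp only [P, Polynomial.eval_finsetSum, Polynomial.eval_monomial, Polynomial.eval_zero]
    rw [← h1]
    exact Finset.sum_congr rfl fun j _ => by rw [map_smul, smul_eq_mul, mul_comm]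
  have h2 : P.coeff j = f (v j) := by
    simp only [P, Polynomial.finsetSum_coeff, Polynomial.coeff_monomial]
    rw [Finset.sum_ite_eq' (Finset.range N) j, if_pos (Finset.mem_range.2 hj)]
  rw [hP, Polynomial.coeff_zero] at h2
  exact hf h2.symm

/-- The coefficients do not depend on `t`, so a subspace containing all `(a + t x)^m` contains the
linear coefficient; this is the use made of it in `span_pow_ι`. The constant coefficient is recorded
because the recursion for `v 1` needs it. -/
theorem exists_add_smul_pow_eq_sum {k A : Type*} [CommRing k] [Ring A] [Algebra k A] (a x : A)
    (m : ℕ) : ∃ v : ℕ → A, (∀ j, m < j → v j = 0) ∧ v 0 = a ^ m ∧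
      v 1 = ∑ i ∈ Finset.range m, a ^ i * x * a ^ (m - 1 - i) ∧
      ∀ t : k, (a + t • x) ^ m = ∑ j ∈ Finset.range (m + 1), t ^ j • v j := by
  induction m with
  | zero =>
    refine ⟨fun j => if j = 0 then 1 else 0, fun j hj => if_neg (by omega), by simp, by simp, ?_⟩
    simp
  | succ m ih =>
    obtain ⟨v, h0, h1, h2, h3⟩ := ih
    -- The recursion from multiplying the expansion on the right by `a + t x`; the case `j = 0` has
    -- no second term.
    refine ⟨fun j => v j * a + if j = 0 then 0 else v (j - 1) * x, fun j hj => ?_, ?_, ?_,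
      fun t => ?_⟩
    · simp only [h0 j (by omega), h0 (j - 1) (by omega), zero_mul, ite_self, add_zero]
    · simp only [h1, if_true, add_zero, pow_succ]
    · simp only [h2, if_neg one_ne_zero, Nat.sub_self, h1]
      rw [Finset.sum_range_succ, Finset.sum_mul, Nat.add_sub_cancel, Nat.sub_self, pow_zero,
        mul_one]
      congr 1
      refine Finset.sum_congr rfl fun i hi => ?_
      rw [mul_assoc _ _ a, ← pow_succ]
      congr 2
      have := Finset.mem_range.1 hi
      omega
    · rw [pow_succ, h3 t]
      simp only [smul_add, Finset.sum_add_distrib]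
      rw [mul_add, Finset.sum_mul, Finset.sum_mul, Finset.sum_range_succ _ (m + 1),
        h0 (m + 1) (by omega), zero_mul, smul_zero, add_zero,
        Finset.sum_range_succ' (fun j => t ^ j • if j = 0 then 0 else v (j - 1) * x) (m + 1)]
      simp only [smul_mul_assoc, Nat.add_sub_cancel, if_true, smul_zero, add_zero,
        if_neg (Nat.succ_ne_zero _), mul_smul_comm]
      congr 1
      exact Finset.sum_congr rfl fun j _ => by rw [smul_smul, pow_succ']

end PowerExpansion

namespace UniversalEnvelopingAlgebra

variable {k : Type*} [Field k] [CharZero k] {L : Type*} [LieRing L] [LieAlgebra k L]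

/-- The enveloping algebra is spanned by the powers of elements of the Lie algebra. -/
theorem span_pow_ι : Submodule.span k {u | ∃ (a : L) (n : ℕ), u = ι k a ^ n} = ⊤ := by
  let S : ℕ → Submodule k (UniversalEnvelopingAlgebra k L) := fun n =>
    Submodule.span k {u | ∃ (a : L) (m : ℕ), m ≤ n ∧ u = ι k a ^ m}
  have hS : Monotone S := fun m n h => Submodule.span_mono fun u ⟨a, i, hi, hu⟩ =>
    ⟨a, i, hi.trans h, hu⟩
  let V : Submodule k (UniversalEnvelopingAlgebra k L) :=
    1 ⊔ LinearMap.range (ι k : L →ₗ⁅k⁆ UniversalEnvelopingAlgebra k L).toLinearMap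
  have h1V : (1 : UniversalEnvelopingAlgebra k L) ∈ V :=
    Submodule.mem_sup_left (Submodule.mem_one.2 ⟨1, map_one _⟩)
  have hιV : ∀ x : L, ι k x ∈ V := fun x => Submodule.mem_sup_right ⟨x, rfl⟩
  -- Moving `x` past `a^i` costs only a term of degree `i`, one less than the product itself.
  have hcomm : ∀ (a x : L) (i : ℕ), ι k a ^ i * ι k x - ι k x * ι k a ^ i ∈ V ^ i := by
    intro a x i
    induction i with
    | zero => simp
    | succ i ih =>
      have e : ι k a ^ (i + 1) * ι k x - ι k x * ι k a ^ (i + 1) =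
          ι k a * (ι k a ^ i * ι k x - ι k x * ι k a ^ i) + ι k ⁅a, x⁆ * ι k a ^ i := by
        rw [LieHom.map_lie, LieRing.of_associative_ring_bracket, pow_succ' (ι k a)]
        noncomm_ring
      rw [e, pow_succ']
      exact add_mem (Submodule.mul_mem_mul (hιV a) ih)
        (Submodule.mul_mem_mul (hιV _) (Submodule.pow_mem_pow _ (hιV a) i))
  have hVmono : ∀ {i j : ℕ}, i ≤ j → V ^ i ≤ V ^ j := fun {i j} h =>
    pow_le_pow_right₀ (Submodule.one_le.2 h1V) h
  have key : ∀ n, V ^ n ≤ S n := by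
    intro n
    induction n with
    | zero =>
      rw [pow_zero, Submodule.one_le]
      exact Submodule.subset_span ⟨0, 0, le_rfl, by simp⟩
    | succ n ih =>
      rw [pow_succ', Submodule.mul_le]
      intro v hv u hu
      have hu := ih hu
      obtain ⟨r, hr, _, ⟨x, rfl⟩, rfl⟩ := Submodule.mem_sup.1 hv
      obtain ⟨r, rfl⟩ := Submodule.mem_one.1 hr
      rw [add_mul, ← Algebra.smul_def]
      refine add_mem (Submodule.smul_mem _ _ (hS (Nat.le_succ n) hu)) ?_
      refine (Submodule.span_le.2 ?_ : S n ≤ (S (n + 1)).comap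
        (LinearMap.mulLeft k (ι k x))) hu
      rintro _ ⟨a, m, hm, rfl⟩
      change ι k x * ι k a ^ m ∈ S (n + 1)
      -- Polarisation: the linear coefficient of `(a + t x)^(m + 1)` is the sum of the words with
      -- one `x` and `m` letters `a`. Modulo lower degree each word is `x a^m`, so `(m + 1) x a^m`
      -- is a combination of powers, and characteristic zero allows division by `m + 1`.
      obtain ⟨v, -, -, hv1, hv⟩ := exists_add_smul_pow_eq_sum (k := k) (ι k a) (ι k x) (m + 1)
      have h1 : v 1 ∈ S (n + 1) := by
        refine Submodule.mem_of_forall_sum_pow_smul_mem (N := m + 1 + 1) _ (fun t => ?_) (by omega)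
        rw [← hv, ← map_smul, ← map_add]
        exact Submodule.subset_span ⟨_, m + 1, by omega, rfl⟩
      have h2 : v 1 - (m + 1 : k) • (ι k x * ι k a ^ m) ∈ S (n + 1) := by
        have e : (m + 1 : k) • (ι k x * ι k a ^ m) =
            ∑ i ∈ Finset.range (m + 1), ι k x * ι k a ^ m := by
          rw [Finset.sum_const, Finset.card_range, ← Nat.cast_smul_eq_nsmul k, Nat.cast_add,
            Nat.cast_one]
        rw [hv1, e, ← Finset.sum_sub_distrib]
        refine sum_mem fun i hi => hS (Nat.le_succ n) (ih ?_)
        have hi := Finset.mem_range.1 hi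
        have e2 : ι k a ^ i * ι k x * ι k a ^ (m + 1 - 1 - i) - ι k x * ι k a ^ m =
            (ι k a ^ i * ι k x - ι k x * ι k a ^ i) * ι k a ^ (m - i) := by
          rw [sub_mul, mul_assoc (ι k x), ← pow_add, Nat.add_sub_cancel,
            Nat.add_sub_cancel' (by omega)]
        rw [e2]
        refine hVmono hm ?_
        have := Submodule.mul_mem_mul (hcomm a x i) (Submodule.pow_mem_pow _ (hιV a) (m - i))
        rwa [← pow_add, Nat.add_sub_cancel' (by omega)] at this
      have h3 := sub_mem h1 h2
      rw [sub_sub_cancel] at h3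
      exact (Submodule.smul_mem_iff _ (Nat.cast_add_one_ne_zero m)).1 h3
  have hle : ∀ n, S n ≤ Submodule.span k {u | ∃ (a : L) (n : ℕ), u = ι k a ^ n} := fun n =>
    Submodule.span_mono fun u ⟨a, m, _, hu⟩ => ⟨a, m, hu⟩
  have hV : ∀ u, u ∈ (⨆ n, V ^ n : Submodule k (UniversalEnvelopingAlgebra k L)) := by
    refine eq_top_of_left _ (Submodule.mem_iSup_of_mem 0 (by
      rw [pow_zero]; exact Submodule.mem_one.2 ⟨1, map_one _⟩)) fun x u hu => ?_
    refine (iSup_le fun n => fun u hu => ?_ : (⨆ n, V ^ n) ≤ (⨆ n, V ^ n).comap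
      (LinearMap.mulLeft k (ι k x))) hu
    refine Submodule.mem_iSup_of_mem (n + 1) ?_
    rw [pow_succ']
    exact Submodule.mul_mem_mul (hιV x) hu
  exact top_unique fun u _ => iSup_le (fun n => (key n).trans (hle n)) (hV u)

end UniversalEnvelopingAlgebra

/-! ### The truncated identity `log (exp X) = X` for power series. -/

namespace PowerSeries

variable (k : Type*) [Field k] [CharZero k]

/-- The truncated identity `log (exp X) = X`. -/
theorem coeff_sum_log_exp (N n : ℕ) (hn : n ≤ N) :
    coeff n (∑ m ∈ Finset.range N, ((-1 : k) ^ m / (m + 1)) • (exp k - 1) ^ (m + 1)) =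
      if n = 1 then 1 else 0 := by
  -- Differentiating termwise turns the logarithm into a finite geometric series in `1 - exp X`. Its
  -- remainder `(1 - exp X)^N` has order at least `N`, so the sum has derivative `1` up to that
  -- order.
  have hd : derivative k (∑ m ∈ Finset.range N, ((-1 : k) ^ m / (m + 1)) • (exp k - 1) ^ (m + 1))
      = 1 - (1 - exp k) ^ N := by
    have h : ∀ m : ℕ, derivative k (((-1 : k) ^ m / (m + 1)) • (exp k - 1) ^ (m + 1)) =
        (1 - exp k) ^ m * exp k := fun m => by
      have h1 : derivative k (exp k - 1) = exp k := by
        rw [map_sub, derivative_exp, derivative_one, sub_zero]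
      rw [Derivation.map_smul, derivative_pow, h1, Nat.add_sub_cancel, ← neg_sub (exp k) 1, neg_pow (exp k - 1)]
      have h2 : ((m + 1 : ℕ) : PowerSeries k) = C (m + 1 : k) := by simp
      rw [h2, smul_eq_C_mul, ← mul_assoc, ← mul_assoc, ← map_mul,
        div_mul_cancel₀ _ (Nat.cast_add_one_ne_zero m)]
      simp
    rw [map_sum, Finset.sum_congr rfl fun m _ => h m, ← Finset.sum_mul]
    have := geom_sum_mul_neg (1 - exp k) N
    rwa [sub_sub_cancel] at this
  have h0 : constantCoeff (exp k - 1) = 0 := by simp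
  have hpow : ∀ N n, n < N → coeff n ((1 - exp k) ^ N) = 0 := fun N n hn =>
    coeff_of_lt_order _ (lt_of_lt_of_le (by exact_mod_cast hn)
      (le_order_pow_of_constantCoeff_eq_zero N (by simp)))
  cases n with
  | zero =>
    rw [coeff_zero_eq_constantCoeff_apply, map_sum, if_neg zero_ne_one]
    refine Finset.sum_eq_zero fun m _ => ?_
    rw [constantCoeff_smul, map_pow, h0, zero_pow (Nat.succ_ne_zero m), smul_zero]
  | succ n =>
    have h1 := congrArg (coeff n) hd
    rw [coeff_derivative, map_sub, hpow N n (by omega), sub_zero, coeff_one] at h1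
    have h2 : (n + 1 : k) ≠ 0 := Nat.cast_add_one_ne_zero n
    rcases Nat.eq_zero_or_pos n with rfl | hn0
    · simpa using h1
    · rw [if_neg (by omega)] at h1 ⊢
      exact (mul_eq_zero.1 h1).resolve_right h2

end PowerSeries

/-! ### Convolution powers of `J` on powers of Lie elements. -/

namespace UniversalEnvelopingAlgebra

variable {k : Type*} [Field k] {L : Type*} [LieRing L] [LieAlgebra k L]

theorem ι_pow_mem_aug_pow (a : L) (n : ℕ) : ι k a ^ n ∈ aug k L ^ n := by
  induction n with
  | zero => rw [Submodule.pow_zero, Ideal.one_eq_top]; trivial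
  | succ n ih =>
    rw [pow_succ, Submodule.pow_succ]
    exact Ideal.mul_mem_mul ih (ι_mem_aug a)

theorem comul_ι_pow (a : L) (n : ℕ) : Coalgebra.comul (R := k) (ι k a ^ n) =
    ∑ p ∈ Finset.HasAntidiagonal.antidiagonal n, (n.choose p.1 : k) • ((ι k a ^ p.1) ⊗ₜ[k] (ι k a ^ p.2)) := by
  have hc : Commute (ι k a ⊗ₜ[k] (1 : UniversalEnvelopingAlgebra k L)) (1 ⊗ₜ[k] ι k a) := by
    simp only [Commute, SemiconjBy, Algebra.TensorProduct.tmul_mul_tmul, one_mul, mul_one]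
  rw [Bialgebra.comul_pow, comul_ι, hc.add_pow']
  refine Finset.sum_congr rfl fun p _ => ?_
  rw [Algebra.TensorProduct.tmul_pow, Algebra.TensorProduct.tmul_pow, one_pow, one_pow,
    Algebra.TensorProduct.tmul_mul_tmul, one_mul, mul_one, Nat.cast_smul_eq_nsmul]

/-- Exponential generating functions turn convolution into multiplication: the binomial coefficients
in the coproduct of `a^n` cancel against the factorials and leave the Cauchy product. -/
theorem factorial_convolution {n : ℕ} (P Q : PowerSeries k) :
    ∑ p ∈ Finset.HasAntidiagonal.antidiagonal n, (n.choose p.1 : k) *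
      ((p.1.factorial * PowerSeries.coeff p.1 P) * (p.2.factorial * PowerSeries.coeff p.2 Q)) =
    n.factorial * PowerSeries.coeff n (P * Q) := by
  rw [PowerSeries.coeff_mul, Finset.mul_sum]
  refine Finset.sum_congr rfl fun p hp => ?_
  obtain rfl := Finset.HasAntidiagonal.mem_antidiagonal.1 hp
  rw [← Nat.add_choose_mul_factorial_mul_factorial p.1 p.2, Nat.choose_symm_add]
  push_cast
  ring

/-- Each `a^n` is an eigenvector. The generating function of the eigenvalues is `exp X` for the
identity and `1` for the convolution unit, hence `exp X - 1` for their difference, and convolution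
powers become ordinary powers. -/
theorem ofConv_J_pow_ι_pow [CharZero k] (a : L) (m n : ℕ) :
    ((WithConv.toConv (LinearMap.id : _ →ₗ[k] _) - 1 : WithConv (UniversalEnvelopingAlgebra k L →ₗ[k]
      UniversalEnvelopingAlgebra k L)) ^ m).ofConv (ι k a ^ n) =
    ((n.factorial : k) * PowerSeries.coeff n ((PowerSeries.exp k - 1) ^ m)) • ι k a ^ n := by
  have h1 : ∀ n, (1 : WithConv (UniversalEnvelopingAlgebra k L →ₗ[k]
      UniversalEnvelopingAlgebra k L)).ofConv (ι k a ^ n) =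
      ((n.factorial : k) * PowerSeries.coeff n (1 : PowerSeries k)) • ι k a ^ n := fun n => by
    change algebraMap k _ (Coalgebra.counit (ι k a ^ n)) = _
    rw [Bialgebra.counit_pow, counit_ι, PowerSeries.coeff_one]
    rcases Nat.eq_zero_or_pos n with rfl | hn
    · simp
    · rw [zero_pow hn.ne', if_neg hn.ne', map_zero, mul_zero, zero_smul]
  have hJ : ∀ n, (WithConv.toConv (LinearMap.id : _ →ₗ[k] _) - 1 :
      WithConv (UniversalEnvelopingAlgebra k L →ₗ[k]
      UniversalEnvelopingAlgebra k L)).ofConv (ι k a ^ n) =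
      ((n.factorial : k) * PowerSeries.coeff n (PowerSeries.exp k - 1)) • ι k a ^ n := fun n => by
    change ι k a ^ n - (1 : WithConv (UniversalEnvelopingAlgebra k L →ₗ[k]
      UniversalEnvelopingAlgebra k L)).ofConv (ι k a ^ n) = _
    have h2 : (n.factorial : k) ≠ 0 := by exact_mod_cast n.factorial_ne_zero
    rw [h1, map_sub, mul_sub, sub_smul, PowerSeries.coeff_exp]
    simp [h2]
  induction m generalizing n with
  | zero => rw [pow_zero, pow_zero]; exact h1 n
  | succ m ih =>
    rw [pow_succ, pow_succ, ← factorial_convolution]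
    change LinearMap.mul' k _ (TensorProduct.map _ _ (Coalgebra.comul (ι k a ^ n))) = _
    rw [comul_ι_pow, map_sum, map_sum, Finset.sum_smul]
    refine Finset.sum_congr rfl fun p hp => ?_
    rw [map_smul, map_smul, TensorProduct.map_tmul, LinearMap.mul'_apply, ih, hJ,
      smul_mul_smul_comm, ← pow_add, Finset.HasAntidiagonal.mem_antidiagonal.1 hp, smul_smul]

end UniversalEnvelopingAlgebra

/-! ### The Euler map and exponentials paired with `U^c(K)`. -/

namespace CompleteLieFiltration

open UniversalEnvelopingAlgebra (ι aug fil cof gen)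
open Module (Dual)

variable {k : Type*} [Field k] {L : Type*} [LieRing L] [LieAlgebra k L]
variable (F : CompleteLieFiltration k L)

theorem incl_mul_pow (f g : F.Uc) (a : L) (n : ℕ) : F.incl (f * g) (ι k a ^ n) =
    ∑ p ∈ Finset.HasAntidiagonal.antidiagonal n, (n.choose p.1 : k) *
      (F.incl f (ι k a ^ p.1) * F.incl g (ι k a ^ p.2)) := by
  rw [incl_mul, UniversalEnvelopingAlgebra.comul_ι_pow, map_sum, map_sum]
  refine Finset.sum_congr rfl fun p _ => ?_
  rw [map_smul, map_smul, TensorProduct.map_tmul, LinearMap.mul'_apply, smul_eq_mul]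

theorem exists_expPoly (a : L) (f : F.Uc) : ∃ P : Polynomial k, ∀ n,
    P.coeff n = (n.factorial : k)⁻¹ * F.incl f (ι k a ^ n) := by
  obtain ⟨N, hN⟩ := F.exists_kill f
  refine ⟨(PowerSeries.mk fun n => (n.factorial : k)⁻¹ * F.incl f (ι k a ^ n)).trunc N,
    fun n => ?_⟩
  rw [PowerSeries.coeff_trunc, PowerSeries.coeff_mk]
  split_ifs with h
  · rfl
  · rw [hN _ (UniversalEnvelopingAlgebra.aug_pow_le_cof _ _
      (UniversalEnvelopingAlgebra.aug_pow_anti (not_lt.1 h)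
        (UniversalEnvelopingAlgebra.ι_pow_mem_aug_pow a n))), mul_zero]

/-- The polynomial `t ↦ ⟨f, exp (t a)⟩`. -/
def expPolyFun (a : L) (f : F.Uc) : Polynomial k := (F.exists_expPoly a f).choose

theorem coeff_expPolyFun (a : L) (f : F.Uc) (n : ℕ) :
    (F.expPolyFun a f).coeff n = (n.factorial : k)⁻¹ * F.incl f (ι k a ^ n) :=
  (F.exists_expPoly a f).choose_spec n

variable [CharZero k]

theorem ext_incl_pow {f g : F.Uc} (h : ∀ a n, F.incl f (ι k a ^ n) = F.incl g (ι k a ^ n)) :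
    f = g := by
  refine F.incl_injective (LinearMap.ext_on UniversalEnvelopingAlgebra.span_pow_ι ?_)
  rintro _ ⟨a, n, rfl⟩
  exact h a n

/-- The Euler map picks out the linear part. -/
theorem incl_euler_pow (f : F.Uc) (a : L) (n : ℕ) :
    F.incl (F.euler f) (ι k a ^ n) = if n = 1 then F.incl f (ι k a) else 0 := by
  obtain ⟨N, hN⟩ := (F.finite_support_euler f).bddAbove
  -- The cutoff must exceed the support bound `N` and also be at least `n`, so that the truncated
  -- identity `log (exp X) = X` covers the coefficient of degree `n`.
  rw [euler, finsum_eq_sum_of_support_subset (s := Finset.range (max (N + 1) n)) _ fun m hm => by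
    have := hN hm
    simp only [Finset.coe_range, Set.mem_Iio]; omega]
  have h := PowerSeries.coeff_sum_log_exp k (max (N + 1) n) n (le_max_right _ _)
  rw [map_sum] at h
  rw [map_sum, LinearMap.sum_apply]
  have h2 : ∀ m : ℕ, F.incl (((-1 : k) ^ m / (m + 1)) • (F.J ^ (m + 1)).ofConv f) (ι k a ^ n) =
      PowerSeries.coeff n (((-1 : k) ^ m / (m + 1)) • (PowerSeries.exp k - 1) ^ (m + 1)) *
        (n.factorial * F.incl f (ι k a ^ n)) := fun m => by
    rw [map_smul, LinearMap.smul_apply, F.J_pow_adjoint,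
      UniversalEnvelopingAlgebra.ofConv_J_pow_ι_pow, map_smul, PowerSeries.coeff_smul, smul_eq_mul,
      smul_eq_mul]
    ring
  rw [Finset.sum_congr rfl fun m _ => h2 m, ← Finset.sum_mul, h]
  split_ifs with h1
  · subst h1; simp [-UniversalEnvelopingAlgebra.ι_apply]
  · rw [zero_mul]

/-! ### Exponentials as characters of `U^c(K)` -/

/-- The polynomial `t ↦ ⟨f, exp (t a)⟩`, as an algebra homomorphism in `f`. -/
def expPoly (a : L) : F.Uc →ₐ[k] Polynomial k :=
  AlgHom.ofLinearMap
    { toFun := F.expPolyFun a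
      map_add' := fun f g => Polynomial.ext fun n => by
        rw [Polynomial.coeff_add, coeff_expPolyFun, coeff_expPolyFun, coeff_expPolyFun, map_add,
          LinearMap.add_apply, mul_add]
      map_smul' := fun r f => Polynomial.ext fun n => by
        rw [Polynomial.coeff_smul, coeff_expPolyFun, coeff_expPolyFun, map_smul,
          LinearMap.smul_apply, RingHom.id_apply, smul_eq_mul, smul_eq_mul, mul_left_comm] }
    (Polynomial.ext fun n => by
      refine (F.coeff_expPolyFun a 1 n).trans ?_
      rw [incl_one, Bialgebra.counit_pow, UniversalEnvelopingAlgebra.counit_ι,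
        Polynomial.coeff_one]
      rcases Nat.eq_zero_or_pos n with rfl | hn
      · simp
      · rw [zero_pow hn.ne', mul_zero, if_neg hn.ne'])
    -- Multiplicativity expresses that `exp (t a)` is group-like: `a^n / n!` has the coproduct of a
    -- divided power, so the coefficients of a shuffle product are those of a product of
    -- polynomials.
    fun f g => Polynomial.ext fun n => by
      refine (F.coeff_expPolyFun a _ n).trans ((?_ : _ = _).trans (Polynomial.coeff_mul
        (F.expPolyFun a f) (F.expPolyFun a g) n).symm)
      rw [incl_mul_pow, Finset.mul_sum]
      refine Finset.sum_congr rfl fun p hp => ?_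
      rw [coeff_expPolyFun, coeff_expPolyFun]
      obtain rfl := Finset.HasAntidiagonal.mem_antidiagonal.1 hp
      have h1 : ((p.1 + p.2).factorial : k) ≠ 0 := by exact_mod_cast Nat.factorial_ne_zero _
      have h2 : (p.1.factorial : k) ≠ 0 := by exact_mod_cast Nat.factorial_ne_zero _
      have h3 : (p.2.factorial : k) ≠ 0 := by exact_mod_cast Nat.factorial_ne_zero _
      have h := congrArg (Nat.cast (R := k)) (Nat.add_choose_mul_factorial_mul_factorial p.1 p.2)
      rw [← Nat.choose_symm_add] at h
      push_cast at h
      generalize F.incl f (ι k a ^ p.1) = x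
      generalize F.incl g (ι k a ^ p.2) = y
      field_simp
      rw [← h]
      ring

theorem coeff_expPoly (a : L) (f : F.Uc) (n : ℕ) :
    (F.expPoly a f).coeff n = (n.factorial : k)⁻¹ * F.incl f (ι k a ^ n) :=
  F.coeff_expPolyFun a f n

/-- The character `f ↦ ⟨f, exp a⟩` of `U^c(K)`. -/
def expChar (a : L) : F.Uc →ₐ[k] k := (Polynomial.aeval 1).comp (F.expPoly a)

/-- The truncated exponential in `U(L)`. -/
def truncExp (k : Type*) [Field k] {L : Type*} [LieRing L] [LieAlgebra k L] (N : ℕ) (a : L) :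
    UniversalEnvelopingAlgebra k L :=
  ∑ n ∈ Finset.range N, (n.factorial : k)⁻¹ • ι k a ^ n

/-- The exponential series terminates against `f`. Any sufficiently large truncation may be used, so
one truncation can serve several functionals at once. -/
theorem expChar_eq (a : L) {f : F.Uc} {N : ℕ} (hN : ∀ u ∈ aug k L ^ N, F.incl f u = 0) :
    F.expChar a f = F.incl f (truncExp k N a) := by
  have h : F.expPoly a f = ∑ n ∈ Finset.range N,
      Polynomial.monomial n ((n.factorial : k)⁻¹ * F.incl f (ι k a ^ n)) := by
    ext n
    simp only [Polynomial.finsetSum_coeff, Polynomial.coeff_monomial, Finset.sum_ite_eq',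
      Finset.mem_range, coeff_expPoly]
    split_ifs with h
    · rfl
    · rw [hN _ (UniversalEnvelopingAlgebra.aug_pow_anti (not_lt.1 h)
        (UniversalEnvelopingAlgebra.ι_pow_mem_aug_pow a n)), mul_zero]
  rw [expChar, AlgHom.comp_apply, h, truncExp, map_sum, map_sum]
  refine Finset.sum_congr rfl fun n _ => ?_
  simp [-UniversalEnvelopingAlgebra.ι_apply, Polynomial.aeval_monomial]

/-- Replacing `a` by `t a` turns the value into a polynomial in `t` with coefficients `f(a^n) / n!`.
Over an infinite field its values determine these coefficients, and the powers `a^n` span `U(L)`. -/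
theorem ext_expChar {f g : F.Uc} (h : ∀ a, F.expChar a f = F.expChar a g) : f = g := by
  have key : ∀ a, F.expPoly a f = F.expPoly a g := fun a => Polynomial.funext fun t => by
    have h1 : ∀ f, F.expChar (t • a) f = (F.expPoly a f).eval t := fun f => by
      have e : F.expPoly (t • a) f = (F.expPoly a f).comp (Polynomial.C t * Polynomial.X) := by
        ext n
        rw [Polynomial.comp_C_mul_X_coeff, coeff_expPoly, coeff_expPoly, map_smul, smul_pow,
          map_smul, smul_eq_mul]
        ring
      rw [expChar, AlgHom.comp_apply, e]
      simp [Polynomial.aeval_def, Polynomial.eval_comp, Polynomial.eval₂_eq_eval_map]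
    rw [← h1, ← h1, h]
  refine F.ext_incl_pow fun a n => ?_
  have h1 := congrArg (Polynomial.coeff · n) (key a)
  simp only [coeff_expPoly] at h1
  exact mul_left_cancel₀ (inv_ne_zero (by exact_mod_cast n.factorial_ne_zero)) h1

end CompleteLieFiltration

/-! ### Polynomial functions and the isomorphism of `Sym(K)` with `U^c(K)`. -/

namespace AffineSpace

open Module (Dual)

/-- Over an infinite field, elements of the symmetric algebra are determined by their values as
polynomial functions. -/
theorem ext_ev {k : Type*} [Field k] [Infinite k] {W : Type*} [AddCommGroup W] [Module k W]
    {s t : SymmetricAlgebra k W} (h : ∀ v : Dual k W, ev v s = ev v t) : s = t := by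
  let b := Module.Basis.ofVectorSpace k W
  apply (SymmetricAlgebra.equivMvPolynomial b).injective
  refine MvPolynomial.funext fun x => ?_
  have key : (MvPolynomial.aeval x).comp (SymmetricAlgebra.equivMvPolynomial b).toAlgHom =
      ev (b.constr k x) := by
    apply SymmetricAlgebra.algHom_ext
    refine b.ext fun i => ?_
    simp [ev]
  have h1 : ∀ s, MvPolynomial.eval x (SymmetricAlgebra.equivMvPolynomial b s) =
      ev (b.constr k x) s := fun s => by
    rw [← key, ← MvPolynomial.coe_aeval_eq_eval]; rfl
  rw [h1, h1, h]

end AffineSpace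

namespace CompleteLieFiltration

open UniversalEnvelopingAlgebra (ι aug fil cof gen)
open Module (Dual)

variable {k : Type*} [Field k] {L : Type*} [LieRing L] [LieAlgebra k L]
variable (F : CompleteLieFiltration k L)

theorem res_apply (f : F.Uc) (x : L) : F.kVal (F.res f) x = F.incl f (ι k x) := rfl

theorem kVal_injective : Function.Injective F.kVal := Subtype.val_injective

/-- A functional on `L` that factors through `L_p` must be extended to `U(L_p)` so as to kill a
power of the augmentation ideal. Birkhoff's embedding of `L_p` into the quotient by such a power
makes this possible: a linear retraction of the quotient onto `L_p` is composed with the functional.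
-/
theorem res_surjective : Function.Surjective F.res := by
  intro κ
  obtain ⟨p, hp⟩ := F.mem_K.1 κ.2
  have h0 : F.quotSub p (p + 1) = ⊥ := by
    refine (Submodule.eq_bot_iff _).2 ?_
    rintro _ ⟨x, hx, rfl⟩
    exact F.quotMap_eq_zero.2 hx
  obtain ⟨n, hn⟩ := UniversalEnvelopingAlgebra.exists_pow_aug_inf_eq_zero
    (L := L ⧸ F.ideal (p + 1)) _ rfl (F.quotSub p) (F.quotSub_anti p) (by
      rw [quotSub, sub, F.one_eq_top]
      exact (Submodule.map_top _).trans (LinearMap.range_eq_top.2 (F.quotMap_surjective p)))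
    (by
      rintro i x _ ⟨y, hy, rfl⟩
      obtain ⟨x, rfl⟩ := F.quotMap_surjective p x
      refine ⟨⁅x, y⁆, ?_, LieHom.map_lie (F.quotMap p) x y⟩
      have := F.lie_mem 1 i x (by rw [F.one_eq_top]; trivial) y hy
      rwa [add_comm] at this) p h0
  let S := (aug k (L ⧸ F.ideal (p + 1)) ^ n).restrictScalars k
  let j : (L ⧸ F.ideal (p + 1)) →ₗ[k] _ :=
    S.mkQ ∘ₗ (ι k : (L ⧸ F.ideal (p + 1)) →ₗ⁅k⁆ _).toLinearMap
  have hj : LinearMap.ker j = ⊥ := LinearMap.ker_eq_bot'.2 fun a ha =>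
    hn a ((Submodule.Quotient.mk_eq_zero S).1 ha)
  obtain ⟨r, hr⟩ := j.exists_leftInverse_of_injective hj
  let κ' : Dual k (L ⧸ F.ideal (p + 1)) := (F.sub (p + 1)).liftQ κ.1 fun x hx => hp x hx
  let f : Dual k (UniversalEnvelopingAlgebra k L) := κ' ∘ₗ r ∘ₗ S.mkQ ∘ₗ
    (UniversalEnvelopingAlgebra.lift k ((ι k).comp (F.quotMap p))).toLinearMap
  -- `F^(m+1+m)` of `U(L_p)` lies in `cof m`. Since `m ≥ n` its power part is in the `n`-th power of
  -- the augmentation ideal, and since `m ≥ p + 1` its other part is zero, because `L^(p+1)` dies in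
  -- `L_p`.
  let m := max n (p + 1)
  have hf : f ∈ F.ucSub := F.mem_ucSub.2 ⟨m + m + 1, fun u hu => by
    have h1 := F.cof_le_ker_proj (m + m) p (m + m + 1) le_rfl (by omega) hu
    have h2 := Ideal.Quotient.eq_zero_iff_mem.1 (show Ideal.Quotient.mk _ _ = 0 from h1)
    have h3 := UniversalEnvelopingAlgebra.fil_le_cof (F.quotSub p) (F.quotSub_anti p) m
      (by rwa [show m + 1 + m = m + m + 1 by omega])
    have h4 : cof (F.quotSub p) m ≤ aug k _ ^ n := by
      refine sup_le (UniversalEnvelopingAlgebra.aug_pow_anti (le_max_left _ _))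
        (UniversalEnvelopingAlgebra.gen_le fun x hx => ?_)
      have hx := F.quotSub_anti p (le_max_right n (p + 1)) hx
      rw [h0, Submodule.mem_bot] at hx
      rw [hx, map_zero]
      exact zero_mem _
    have h5 : S.mkQ (UniversalEnvelopingAlgebra.lift k ((ι k).comp (F.quotMap p)) u) = 0 :=
      (Submodule.Quotient.mk_eq_zero S).2 (h4 h3)
    change κ' (r (S.mkQ (UniversalEnvelopingAlgebra.lift k ((ι k).comp (F.quotMap p)) u))) = 0
    rw [h5, map_zero, map_zero]⟩
  refine ⟨⟨WithConv.toConv f, hf⟩, F.kVal_injective (LinearMap.ext fun x => ?_)⟩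
  change κ' (r (S.mkQ (UniversalEnvelopingAlgebra.lift k ((ι k).comp (F.quotMap p)) (ι k x)))) = _
  rw [UniversalEnvelopingAlgebra.lift_ι_apply]
  change κ' ((r ∘ₗ j) (F.quotMap p x)) = _
  rw [hr]
  rfl

/-- Coordinates on `L` modulo a step of the filtration. -/
theorem exists_coordinates (N : ℕ) : ∃ (m : ℕ) (x : Fin m → L) (κ : Fin m → F.K),
    ∀ a, a - ∑ i, F.kVal (κ i) a • x i ∈ F.sub N := by
  -- The quotient by `L^(N+1)` is used rather than by `L^N`, because finiteness is given for
  -- successor indices, including when `N = 0`.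
  let b := Module.finBasis k (L ⧸ F.ideal (N + 1))
  choose x hx using fun i => F.quotMap_surjective N (b i)
  refine ⟨_, x, fun i => ⟨(b.coord i) ∘ₗ (F.quotMap N).toLinearMap,
    Submodule.mem_iSup_of_mem N ⟨b.coord i, rfl⟩⟩, fun a => F.sub_anti (Nat.le_succ N) ?_⟩
  rw [← F.quotMap_eq_zero, map_sub, map_sum, sub_eq_zero]
  simp only [map_smul, hx]
  exact (b.sum_repr (F.quotMap N a)).symm

/-- The function `a ↦ ⟨f, exp a⟩` on `L` is polynomial. -/
theorem exists_ev_eq_expChar [CharZero k] (f : F.Uc) : ∃ s : SymmetricAlgebra k F.K,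
    ∀ a, AffineSpace.ev (F.dualEquiv a) s = F.expChar a f := by
  obtain ⟨N, hN⟩ := F.exists_kill f
  obtain ⟨m, x, κ, hx⟩ := F.exists_coordinates N
  -- The claim is made for arbitrary functionals `g`, so that the induction can absorb the leading
  -- factor `x i` into `g`.
  have key : ∀ n, ∀ g : Dual k (UniversalEnvelopingAlgebra k L), ∃ s : SymmetricAlgebra k F.K,
      ∀ a, AffineSpace.ev (F.dualEquiv a) s = g (ι k (∑ i, F.kVal (κ i) a • x i) ^ n) := by
    intro n
    induction n with
    | zero =>
      intro g
      exact ⟨algebraMap k _ (g 1), fun a => by rw [AlgHom.commutes, pow_zero]; rfl⟩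
    | succ n ih =>
      intro g
      choose s hs using fun i => ih (g ∘ₗ LinearMap.mulLeft k (ι k (x i)))
      refine ⟨∑ i, SymmetricAlgebra.ι k F.K (κ i) * s i, fun a => ?_⟩
      have e : ι k (∑ i, F.kVal (κ i) a • x i) = ∑ i, F.kVal (κ i) a • ι k (x i) := by
        simp only [map_sum, map_smul]
      have hs := fun i => hs i a
      -- The power is hidden behind a variable so that only its first factor gets expanded in
      -- coordinates.
      generalize ι k (∑ i, F.kVal (κ i) a • x i) = y at e hs ⊢
      rw [map_sum, pow_succ']
      nth_rw 1 [e]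
      rw [Finset.sum_mul, map_sum]
      refine Finset.sum_congr rfl fun i _ => ?_
      rw [map_mul, hs, smul_mul_assoc, map_smul, smul_eq_mul, AffineSpace.ev,
        SymmetricAlgebra.lift_ι_apply, dualEquiv_apply]
      rfl
  choose s hs using fun n => key n (F.incl f)
  refine ⟨∑ n ∈ Finset.range N, (n.factorial : k)⁻¹ • s n, fun a => ?_⟩
  rw [F.expChar_eq a fun u hu => hN u (UniversalEnvelopingAlgebra.aug_pow_le_cof _ _ hu), truncExp,
    map_sum, map_sum]
  refine Finset.sum_congr rfl fun n _ => ?_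
  rw [map_smul, map_smul, hs]
  congr 1
  -- Replacing `a` by its finite coordinate expansion changes it by an element of `L^N`; the powers
  -- agree modulo the two-sided ideal `cof N`, which `f` kills.
  refine (sub_eq_zero.1 ?_).symm
  rw [← map_sub]
  refine hN _ ((Ideal.Quotient.mk_eq_mk_iff_sub_mem _ _).1 ?_)
  rw [map_pow, map_pow]
  congr 1
  refine (Ideal.Quotient.mk_eq_mk_iff_sub_mem _ _).2 ?_
  rw [← map_sub]
  exact Ideal.mem_sup_right (UniversalEnvelopingAlgebra.ι_mem_gen (hx a))

variable [CharZero k]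

/-- The section of `res` whose image is the image of the Euler map. -/
theorem exists_eulerSection : ∃ e : F.K →ₗ[k] F.Uc, (∀ κ, F.res (e κ) = κ) ∧
    ∀ f, e (F.res f) = F.euler f := by
  -- On powers `a^n` the Euler map involves only `f(a)`, so it factors through `res`. Composing it
  -- with an arbitrary linear section `σ` of `res` therefore gives a section independent of `σ`.
  have h : ∀ f g : F.Uc, F.res f = F.res g → F.euler f = F.euler g := fun f g hfg =>
    F.ext_incl_pow fun a n => by
      rw [incl_euler_pow, incl_euler_pow, ← res_apply, ← res_apply, hfg]
  have hres : ∀ f, F.res (F.euler f) = F.res f := fun f =>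
    F.kVal_injective (LinearMap.ext fun x => by
      have := F.incl_euler_pow f x 1
      rw [if_pos rfl, pow_one] at this
      exact this)
  -- Linearity is read off from the values on powers instead of from the locally finite sum.
  let E : F.Uc →ₗ[k] F.Uc :=
    { toFun := F.euler
      map_add' := fun f g => F.ext_incl_pow fun a n => by
        rw [map_add, LinearMap.add_apply, incl_euler_pow, incl_euler_pow, incl_euler_pow, map_add,
          LinearMap.add_apply]
        split_ifs <;> simp
      map_smul' := fun r f => F.ext_incl_pow fun a n => by
        rw [map_smul, LinearMap.smul_apply, incl_euler_pow, incl_euler_pow, map_smul,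
          LinearMap.smul_apply, RingHom.id_apply]
        split_ifs <;> simp }
  obtain ⟨σ, hσ⟩ := F.res.exists_rightInverse_of_surjective
    (LinearMap.range_eq_top.2 F.res_surjective)
  have hσ' : ∀ κ, F.res (σ κ) = κ := fun κ => congr($hσ κ)
  exact ⟨E ∘ₗ σ, fun κ => (hres _).trans (hσ' κ), fun f => h _ _ (hσ' _)⟩

/-- The last clause carries the proof: `ψ s` paired with `exp a` is the value of the polynomial `s`
at `a`. On generators it says that `e(f)` sees only the linear term of `exp a`, and characters are
determined on generators. Bijectivity follows, since both sides are determined by these values and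
give the same functions on `L`. -/
theorem exists_symEquiv : ∃ ψ : SymmetricAlgebra k F.K ≃ₐ[k] F.Uc,
    (∀ κ : F.K, F.res (ψ (SymmetricAlgebra.ι k F.K κ)) = κ) ∧
    (∀ f : F.Uc, ψ (SymmetricAlgebra.ι k F.K (F.res f)) = F.euler f) ∧
    ∀ a s, F.expChar a (ψ s) = AffineSpace.ev (F.dualEquiv a) s := by
  obtain ⟨e, he1, he2⟩ := F.exists_eulerSection
  let Ψ : SymmetricAlgebra k F.K →ₐ[k] F.Uc := SymmetricAlgebra.lift e
  have hΨ : ∀ κ, Ψ (SymmetricAlgebra.ι k F.K κ) = e κ := fun κ => SymmetricAlgebra.lift_ι_apply e κ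
  have hev : ∀ a, (F.expChar a).comp Ψ = AffineSpace.ev (F.dualEquiv a) := fun a => by
    apply SymmetricAlgebra.algHom_ext
    refine LinearMap.ext fun κ => ?_
    obtain ⟨f, rfl⟩ := F.res_surjective κ
    change F.expChar a (Ψ (SymmetricAlgebra.ι k F.K (F.res f))) =
      AffineSpace.ev _ (SymmetricAlgebra.ι k F.K (F.res f))
    rw [hΨ, he2, AffineSpace.ev, SymmetricAlgebra.lift_ι_apply, dualEquiv_apply, res_apply]
    have h : F.expPoly a (F.euler f) = Polynomial.monomial 1 (F.incl f (ι k a)) := by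
      ext n
      rw [coeff_expPoly, incl_euler_pow, Polynomial.coeff_monomial]
      rcases eq_or_ne n 1 with rfl | h
      · simp
      · rw [if_neg h, if_neg h.symm, mul_zero]
    rw [expChar, AlgHom.comp_apply, h]
    simp [Polynomial.aeval_monomial]
  have hev' : ∀ a s, F.expChar a (Ψ s) = AffineSpace.ev (F.dualEquiv a) s :=
    fun a s => congr($(hev a) s)
  have hinj : Function.Injective Ψ := fun s t hst => AffineSpace.ext_ev fun v => by
    obtain ⟨a, rfl⟩ := F.dualEquiv.surjective v
    rw [← hev', ← hev', hst]
  have hsurj : Function.Surjective Ψ := fun f => by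
    obtain ⟨s, hs⟩ := F.exists_ev_eq_expChar f
    exact ⟨s, F.ext_expChar fun a => by rw [hev', hs]⟩
  refine ⟨AlgEquiv.ofBijective Ψ ⟨hinj, hsurj⟩, fun κ => ?_, fun f => ?_, hev'⟩
  · exact (congrArg F.res (hΨ κ)).trans (he1 κ)
  · exact (hΨ _).trans (he2 f)

end CompleteLieFiltration

/-! ### Homomorphisms of coordinate rings yield morphisms of varieties. -/

namespace AffineSpace

open Module (Dual)

variable {k : Type*} [Field k]

theorem ev_ι {W : Type*} [AddCommGroup W] [Module k W] (v : Dual k W) (w : W) :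
    ev v (SymmetricAlgebra.ι k W w) = v w :=
  SymmetricAlgebra.lift_ι_apply v w

theorem ev_congr {W : Type*} [AddCommGroup W] [Module k W] {T : Submodule k W} {v v' : Dual k W}
    (h : ∀ w ∈ T, v w = v' w) {s : SymmetricAlgebra k W}
    (hs : s ∈ Algebra.adjoin k (SymmetricAlgebra.ι k W '' T)) : ev v s = ev v' s := by
  refine AlgHom.adjoin_le_equalizer (ev v) (ev v') ?_ hs
  rintro _ ⟨w, hw, rfl⟩
  rw [ev_ι, ev_ι, h w hw]

theorem exists_mem_adjoin {W : Type*} [AddCommGroup W] [Module k W] (s : SymmetricAlgebra k W) :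
    ∃ T : Submodule k W, T.FG ∧ s ∈ Algebra.adjoin k (SymmetricAlgebra.ι k W '' T) := by
  have mono : ∀ {T T' : Submodule k W}, T ≤ T' →
      Algebra.adjoin k (SymmetricAlgebra.ι k W '' T) ≤
        Algebra.adjoin k (SymmetricAlgebra.ι k W '' T') :=
    fun h => Algebra.adjoin_mono (Set.image_mono h)
  induction s using SymmetricAlgebra.induction with
  | algebraMap r => exact ⟨⊥, Submodule.fg_bot, Subalgebra.algebraMap_mem _ r⟩
  | ι x => exact ⟨Submodule.span k {x}, Submodule.fg_span_singleton x,
      Algebra.subset_adjoin ⟨x, Submodule.mem_span_singleton_self x, rfl⟩⟩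
  | mul a b ha hb =>
    obtain ⟨T, hT, ha⟩ := ha
    obtain ⟨T', hT', hb⟩ := hb
    exact ⟨T ⊔ T', hT.sup hT', mul_mem (mono le_sup_left ha) (mono le_sup_right hb)⟩
  | add a b ha hb =>
    obtain ⟨T, hT, ha⟩ := ha
    obtain ⟨T', hT', hb⟩ := hb
    exact ⟨T ⊔ T', hT.sup hT', add_mem (mono le_sup_left ha) (mono le_sup_right hb)⟩

theorem exists_le_adjoin {W : Type*} [AddCommGroup W] [Module k W]
    {S : Submodule k (SymmetricAlgebra k W)} (hS : S.FG) :
    ∃ T : Submodule k W, T.FG ∧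
      S ≤ (Algebra.adjoin k (SymmetricAlgebra.ι k W '' T)).toSubmodule := by
  obtain ⟨Z, rfl⟩ := hS
  choose T hT hs using exists_mem_adjoin (k := k) (W := W)
  refine ⟨Z.sup T, Submodule.fg_finset_sup _ _ fun z _ => hT z, Submodule.span_le.2 fun z hz => ?_⟩
  exact Algebra.adjoin_mono (Set.image_mono (Finset.le_sup (f := T) hz)) (hs z)

variable {V₁ V₂ W₁ W₂ : Type*} [AddCommGroup V₁] [Module k V₁] [AddCommGroup V₂] [Module k V₂]
  [AddCommGroup W₁] [Module k W₁] [AddCommGroup W₂] [Module k W₂]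

/-- Between affine spaces of countable dimension, a map with a homomorphism of coordinate rings is a
morphism. -/
theorem IsComorphism.isMorphism {e₁ : V₁ ≃ₗ[k] Dual k W₁} {e₂ : V₂ ≃ₗ[k] Dual k W₂} {f : V₁ → V₂}
    {φ : SymmetricAlgebra k W₂ →ₐ[k] SymmetricAlgebra k W₁} (h : IsComorphism e₁ e₂ f φ)
    (C : Filtration k W₁) (B : Filtration k W₂) : IsMorphism e₁ e₂ f := by
  -- The pullbacks of finitely many coordinates involve only finitely many coordinates of the
  -- source.
  have hB : ∀ j, ∃ T : Submodule k W₁, T.FG ∧ ∀ b ∈ B.sub j,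
      φ (SymmetricAlgebra.ι k W₂ b) ∈ Algebra.adjoin k (SymmetricAlgebra.ι k W₁ '' T) := fun j => by
    obtain ⟨T, hT, hle⟩ := exists_le_adjoin (((Submodule.fg_iff_finiteDimensional _).2
      (B.finite j)).map (φ.toLinearMap ∘ₗ SymmetricAlgebra.ι k W₂))
    exact ⟨T, hT, fun b hb => hle ⟨b, hb, rfl⟩⟩
  choose T hT hTB using hB
  -- `C` supplies exhaustion, and the spaces `T 1, …, T i` make the pullbacks of `B.sub i` available
  -- at step `i`. `T 0` is left out so that the filtration starts at `0`; nothing is lost because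
  -- `B.sub 0` is zero.
  let A : Filtration k W₁ :=
    { sub := fun i => C.sub i ⊔ (Finset.range i).sup fun j => T (j + 1)
      zero_eq_bot := by simp [C.zero_eq_bot]
      mono := fun i j hij => sup_le_sup (C.mono hij) (Finset.sup_mono (Finset.range_mono hij))
      finite := fun i => (Submodule.fg_iff_finiteDimensional _).1
        (((Submodule.fg_iff_finiteDimensional _).2 (C.finite i)).sup
          (Submodule.fg_finset_sup _ _ fun j _ => hT (j + 1)))
      exhaustive := top_unique (C.exhaustive.symm.le.trans (iSup_mono fun i => le_sup_left)) }
  have hA : ∀ i, ∀ b ∈ B.sub i,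
      φ (SymmetricAlgebra.ι k W₂ b) ∈
        Algebra.adjoin k (SymmetricAlgebra.ι k W₁ '' (A.sub i)) := fun i b hb => by
    cases i with
    | zero =>
      rw [B.zero_eq_bot, Submodule.mem_bot] at hb
      rw [hb, map_zero, map_zero]
      exact zero_mem _
    | succ i =>
      refine Algebra.adjoin_mono (Set.image_mono ?_) (hTB (i + 1) b hb)
      exact (Finset.le_sup (f := fun j => T (j + 1)) (Finset.self_mem_range_succ i)).trans
        le_sup_right
  refine ⟨A, B, fun i => ?_⟩
  -- A linear retraction onto `A.sub i` extends forms on that subspace to `W₁`, giving a definition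
  -- of the descended map. The choice is harmless, because the relevant pullbacks are polynomials in
  -- elements of `A.sub i`.
  obtain ⟨π, hπ⟩ := (A.sub i).subtype.exists_leftInverse_of_injective (A.sub i).ker_subtype
  refine ⟨fun x => (LinearMap.comp (ev (x ∘ₗ π)).toLinearMap
    (φ.toLinearMap ∘ₗ SymmetricAlgebra.ι k W₂)).domRestrict (B.sub i), fun b => ?_, fun v => ?_⟩
  · refine ⟨SymmetricAlgebra.lift (SymmetricAlgebra.ι k _ ∘ₗ π) (φ (SymmetricAlgebra.ι k W₂ b)),
      fun x => ?_⟩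
    have e : (ev x).comp (SymmetricAlgebra.lift (SymmetricAlgebra.ι k _ ∘ₗ π)) = ev (x ∘ₗ π) := by
      apply SymmetricAlgebra.algHom_ext
      ext w
      simp [ev]
    change ev (x ∘ₗ π) _ = _
    rw [← e]
    rfl
  · refine LinearMap.ext fun b => ?_
    change e₂ (f v) b = ev (((e₁ v).domRestrict (A.sub i)) ∘ₗ π) (φ (SymmetricAlgebra.ι k W₂ b))
    rw [← ev_ι, ← h]
    refine ev_congr (fun w hw => ?_) (hA i b b.2)
    have : π w = ⟨w, hw⟩ := congr($hπ ⟨w, hw⟩)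
    rw [LinearMap.comp_apply, this]
    rfl

end AffineSpace

/-! ### The identity `log (exp y) = y` for nilpotent elements. -/

namespace PowerSeries

/-- In an algebra over a field of characteristic zero, `log (exp y) = y` for nilpotent `y`. -/
theorem sum_log_exp_of_pow_eq_zero {k A : Type*} [Field k] [CharZero k] [Ring A] [Algebra k A]
    {y : A} {p : ℕ} (hy : y ^ p = 0) :
    ∑ n ∈ Finset.range p, (if n = 0 then (0 : k) else (-1) ^ (n + 1) / (n : k)) •
      (∑ m ∈ Finset.range p, (m.factorial : k)⁻¹ • y ^ m - 1) ^ n = y := by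
  let c : ℕ → k := fun n => if n = 0 then 0 else (-1) ^ (n + 1) / (n : k)
  let T : Polynomial k := (exp k).trunc p
  -- `P` is the truncated `log (exp X) - X`. It suffices that `X^p` divides `P`, since then `P`
  -- vanishes at `y`; only polynomials in the single element `y` occur, so noncommutativity of `A`
  -- plays no role.
  let P : Polynomial k := ∑ n ∈ Finset.range p, Polynomial.C (c n) * (T - 1) ^ n - Polynomial.X
  have hT : (X : PowerSeries k) ^ p ∣ (T : PowerSeries k) - exp k := by
    rw [X_pow_dvd_iff]
    intro m hm
    rw [map_sub, coeff_coe_trunc_of_lt hm, sub_self]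
  have h1 : (X : PowerSeries k) ^ p ∣ (P : PowerSeries k) := by
    have h2 : (X : PowerSeries k) ^ p ∣ ∑ n ∈ Finset.range p, C (c n) *
        (((T : PowerSeries k) - 1) ^ n - (exp k - 1) ^ n) := Finset.dvd_sum fun n _ =>
      Dvd.dvd.mul_left ((by simpa using hT : (X : PowerSeries k) ^ p ∣
        ((T : PowerSeries k) - 1) - (exp k - 1)).trans (sub_dvd_pow_sub_pow _ _ n)) _
    have h3 : (X : PowerSeries k) ^ p ∣ ∑ n ∈ Finset.range p, C (c n) * (exp k - 1) ^ n - X := by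
      cases p with
      | zero => simp
      | succ q =>
        rw [X_pow_dvd_iff]
        intro d hd
        -- The logarithm here is indexed by the exponent and its term of exponent `0` vanishes, so
        -- `p = q + 1` terms match the `q` terms of the other indexing; the signs `(-1)^(n+2)` and
        -- `(-1)^n` agree.
        have h := coeff_sum_log_exp k q d (by omega)
        rw [Finset.sum_range_succ', map_sub, map_add, coeff_X, ← h]
        have h0 : c 0 = 0 := if_pos rfl
        rw [h0, map_zero, zero_mul, map_zero, add_zero, sub_eq_zero]
        congr 1
        refine Finset.sum_congr rfl fun n _ => ?_
        rw [smul_eq_C_mul]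
        simp only [c, if_neg (Nat.succ_ne_zero n), Nat.cast_add, Nat.cast_one]
        congr 3
        ring
    have h4 : (P : PowerSeries k) = ∑ n ∈ Finset.range p, C (c n) *
        (((T : PowerSeries k) - 1) ^ n - (exp k - 1) ^ n) +
        (∑ n ∈ Finset.range p, C (c n) * (exp k - 1) ^ n - X) := by
      have h5 : (P : PowerSeries k) =
          ∑ n ∈ Finset.range p, C (c n) * ((T : PowerSeries k) - 1) ^ n - X := by
        change Polynomial.coeToPowerSeries.ringHom P = _
        simp only [P, map_sub, map_sum, map_mul, map_pow, map_one,
          Polynomial.coeToPowerSeries.ringHom_apply, Polynomial.coe_C, Polynomial.coe_X]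
      rw [h5]
      simp only [mul_sub, Finset.sum_sub_distrib]
      abel
    rw [h4]
    exact dvd_add h2 h3
  have h6 : (Polynomial.X : Polynomial k) ^ p ∣ P := by
    rw [Polynomial.X_pow_dvd_iff]
    intro d hd
    rw [← Polynomial.coeff_coe]
    exact X_pow_dvd_iff.1 h1 d hd
  have h7 : Polynomial.aeval y P = 0 := by
    obtain ⟨Q, hQ⟩ := h6
    rw [hQ, map_mul, map_pow, Polynomial.aeval_X, hy, zero_mul]
  have h8 : Polynomial.aeval y T = ∑ m ∈ Finset.range p, (m.factorial : k)⁻¹ • y ^ m := by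
    rw [Polynomial.aeval_def, eval₂_trunc_eq_sum_range]
    refine Finset.sum_congr rfl fun m _ => ?_
    rw [coeff_exp, Algebra.smul_def]
    simp
  have h9 : Polynomial.aeval y P = ∑ n ∈ Finset.range p, c n •
      (∑ m ∈ Finset.range p, (m.factorial : k)⁻¹ • y ^ m - 1) ^ n - y := by
    simp only [P, map_sub, map_sum, map_mul, map_pow, map_one, h8, Polynomial.aeval_X,
      Polynomial.aeval_C, Algebra.smul_def]
  exact sub_eq_zero.1 (h9.symm.trans h7)

end PowerSeries

/-! ### Exponentials in the completed enveloping algebra. -/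

namespace CompleteLieFiltration

open UniversalEnvelopingAlgebra (ι aug fil cof gen)
open Module (Dual)

variable {k : Type*} [Field k] {L : Type*} [LieRing L] [LieAlgebra k L]
variable (F : CompleteLieFiltration k L)

/-- The filtration of `K` by the annihilators of the `Lⁱ`. -/
def filtrationK : AffineSpace.Filtration k F.K where
  sub i := (F.sub i).dualAnnihilator.comap F.kVal
  zero_eq_bot := by
    have h : F.sub 0 = ⊤ := top_unique (by
      have := F.sub_anti zero_le_one
      rwa [sub, F.one_eq_top] at this)
    rw [h, Submodule.dualAnnihilator_top]
    exact LinearMap.ker_eq_bot.2 F.kVal_injective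
  mono _ _ h := Submodule.comap_mono (Submodule.dualAnnihilator_anti (F.sub_anti h))
  finite i := by
    let r : Dual k (L ⧸ F.ideal (i + 1)) →ₗ[k] F.K :=
      LinearMap.codRestrict F.kSub (F.quotMap i).toLinearMap.dualMap fun g =>
        Submodule.mem_iSup_of_mem i ⟨g, rfl⟩
    refine Submodule.finiteDimensional_of_le (S₂ := LinearMap.range r) fun κ hκ => ?_
    have h : F.kVal κ ∈ LinearMap.range (F.quotMap i).toLinearMap.dualMap := by
      rw [LinearMap.range_dualMap_eq_dualAnnihilator_ker]
      exact (Submodule.mem_dualAnnihilator _).2 fun x hx =>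
        (Submodule.mem_dualAnnihilator _).1 hκ x
          (F.sub_anti (Nat.le_succ i) (F.quotMap_eq_zero.1 hx))
    obtain ⟨g, hg⟩ := h
    exact ⟨g, Subtype.ext hg⟩
  exhaustive := top_unique fun κ _ => by
    obtain ⟨p, hp⟩ := F.mem_K.1 κ.2
    exact Submodule.mem_iSup_of_mem (p + 1) ((Submodule.mem_dualAnnihilator _).2 hp)

/-- The product filtration of `K ⊕ K`. -/
def filtrationProd : AffineSpace.Filtration k (F.K × F.K) where
  sub i := (F.filtrationK.sub i).prod (F.filtrationK.sub i)
  zero_eq_bot := by rw [F.filtrationK.zero_eq_bot, Submodule.prod_bot]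
  mono _ _ h := Submodule.prod_mono (F.filtrationK.mono h) (F.filtrationK.mono h)
  finite i := by
    have h := (Submodule.fg_iff_finiteDimensional _).2 (F.filtrationK.finite i)
    exact (Submodule.fg_iff_finiteDimensional _).1 (h.prod h)
  exhaustive := top_unique fun κ _ => by
    have h : ∀ κ : F.K, ∃ i, κ ∈ F.filtrationK.sub i := fun κ =>
      (Submodule.mem_iSup_of_directed _ F.filtrationK.mono.directed_le).1
        (F.filtrationK.exhaustive ▸ trivial)
    obtain ⟨i, hi⟩ := h κ.1
    obtain ⟨j, hj⟩ := h κ.2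
    exact Submodule.mem_iSup_of_mem (max i j)
      ⟨F.filtrationK.mono (le_max_left i j) hi, F.filtrationK.mono (le_max_right i j) hj⟩

/-- `K` separates the points of `L`, and surjectivity of `res` extends each element of `K` to a
functional `f` on `U(L)` killing some `cof n`, hence killing `F^(n+1+n)`. So `f` can be evaluated on
a single component of `Û(L)`. -/
theorem ιHat_injective : Function.Injective F.ιHat := by
  intro a b hab
  refine F.dualEquiv.injective (LinearMap.ext fun κ => ?_)
  obtain ⟨f, rfl⟩ := F.res_surjective κ
  rw [dualEquiv_apply, dualEquiv_apply, res_apply, res_apply]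
  obtain ⟨n, hn⟩ := F.exists_kill f
  have h := congrArg (fun x : F.augHat => F.component (n + 1 + n) x.1) hab
  have h2 := (Ideal.Quotient.mk_eq_mk_iff_sub_mem _ _).1 h
  exact sub_eq_zero.1 ((map_sub _ _ _).symm.trans
    (hn _ (UniversalEnvelopingAlgebra.fil_le_cof _ F.sub_anti n h2)))

theorem component_exp (p : ℕ) (x : F.augHat) : F.component p (F.exp x).1 =
    ∑ n ∈ Finset.range p, (n.factorial : k)⁻¹ • F.component p x.1 ^ n := rfl

theorem component_exp_ιHat (p : ℕ) (a : L) : F.component p (F.exp (F.ιHat a)).1 =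
    Ideal.Quotient.mkₐ k (fil F.sub p) (truncExp k p a) := by
  rw [component_exp, truncExp, map_sum]
  exact Finset.sum_congr rfl fun n _ => by rw [map_smul, map_pow]; rfl

theorem ext_component {x y : F.UHat} (h : ∀ p, F.component p x = F.component p y) : x = y :=
  Subtype.ext (funext h)

/-- Modulo `F^p` both series are sums over exponents below `p`, and the component of `x` has
vanishing `p`-th power, so the nilpotent identity applies componentwise. -/
theorem log_exp [CharZero k] (x : F.augHat) : F.log (F.exp x) = x := by
  refine Subtype.ext (F.ext_component fun p => ?_)
  refine Eq.trans ?_ (PowerSeries.sum_log_exp_of_pow_eq_zero (k := k)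
    (F.component_pow_eq_zero x.2 (le_refl p)))
  rw [← component_exp, ← map_one (F.component p), ← map_sub]
  rfl

theorem truncExp_sub_mem_fil {p N : ℕ} (h : p ≤ N) (a : L) :
    truncExp k N a - truncExp k p a ∈ fil F.sub p := by
  rw [truncExp, truncExp, ← Finset.sum_sdiff (Finset.range_mono h), add_sub_cancel_right]
  refine sum_mem fun n hn => ?_
  have hn : p ≤ n := by simpa using (Finset.mem_sdiff.1 hn).2
  exact Submodule.smul_of_tower_mem _ _ (UniversalEnvelopingAlgebra.aug_pow_le_fil _ _
    (UniversalEnvelopingAlgebra.aug_pow_anti hn (UniversalEnvelopingAlgebra.ι_pow_mem_aug_pow a n)))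

theorem ev_prodDualEquiv (a b : L) (s : SymmetricAlgebra k (F.K × F.K)) :
    AffineSpace.ev (F.prodDualEquiv (a, b)) s =
      LinearMap.mul' k k (TensorProduct.map (AffineSpace.ev (F.dualEquiv a)).toLinearMap
        (AffineSpace.ev (F.dualEquiv b)).toLinearMap (AffineSpace.symProd k F.K F.K s)) := by
  have h : AffineSpace.ev (F.prodDualEquiv (a, b)) = ((Algebra.TensorProduct.lmul' k).comp
      (Algebra.TensorProduct.map (AffineSpace.ev (F.dualEquiv a))
        (AffineSpace.ev (F.dualEquiv b)))).comp
      (AffineSpace.symProd k F.K F.K : SymmetricAlgebra k (F.K × F.K) →ₐ[k] _) := by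
    apply SymmetricAlgebra.algHom_ext
    refine LinearMap.ext fun ⟨κ, κ'⟩ => ?_
    change AffineSpace.ev _ (SymmetricAlgebra.ι k _ (κ, κ')) = Algebra.TensorProduct.lmul' k
      (Algebra.TensorProduct.map _ _ (AffineSpace.symProd k F.K F.K
        (SymmetricAlgebra.ι k _ (κ, κ'))))
    rw [AffineSpace.symProd_ι, AffineSpace.ev_ι, prodDualEquiv_apply]
    simp [AffineSpace.ev_ι, dualEquiv_apply]
  rw [h]
  rfl

variable [CharZero k]

/-- A product of exponentials acts on `U^c(K)` through the coproduct. -/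
theorem expChar_tensor (a b : L) (t : F.Uc ⊗[k] F.Uc) : ∃ N₀, ∀ N, N₀ ≤ N →
    LinearMap.mul' k k (TensorProduct.map (F.expChar a).toLinearMap (F.expChar b).toLinearMap t) =
      F.pair t (truncExp k N a ⊗ₜ truncExp k N b) := by
  induction t with
  | zero => exact ⟨0, fun N _ => by simp⟩
  | add x y hx hy =>
    obtain ⟨M, hM⟩ := hx
    obtain ⟨M', hM'⟩ := hy
    refine ⟨max M M', fun N hN => ?_⟩
    rw [map_add, map_add, map_add, LinearMap.add_apply, hM N ((le_max_left _ _).trans hN),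
      hM' N ((le_max_right _ _).trans hN)]
  | tmul f g =>
    obtain ⟨m, hm⟩ := F.exists_kill f
    obtain ⟨n, hn⟩ := F.exists_kill g
    refine ⟨max m n, fun N hN => ?_⟩
    rw [TensorProduct.map_tmul, LinearMap.mul'_apply, pair_tmul]
    congr 1
    · exact F.expChar_eq a fun u hu => hm u (UniversalEnvelopingAlgebra.aug_pow_le_cof _ _
        (UniversalEnvelopingAlgebra.aug_pow_anti ((le_max_left _ _).trans hN) hu))
    · exact F.expChar_eq b fun u hu => hn u (UniversalEnvelopingAlgebra.aug_pow_le_cof _ _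
        (UniversalEnvelopingAlgebra.aug_pow_anti ((le_max_right _ _).trans hN) hu))

/-- If the character `exp c` is the convolution of `exp a` and `exp b`, then
`exp c = exp a • exp b` in `Û(L)`. -/
theorem exp_eq_mul_of_expChar {a b c : L} (h : ∀ f : F.Uc, F.expChar c f =
    LinearMap.mul' k k (TensorProduct.map (F.expChar a).toLinearMap (F.expChar b).toLinearMap
      (Coalgebra.comul (R := k) f))) :
    F.exp (F.ιHat c) = F.exp (F.ιHat a) * F.exp (F.ιHat b) := by
  refine Subtype.ext (F.ext_component fun p => ?_)
  rw [Submonoid.coe_mul, map_mul, component_exp_ιHat, component_exp_ιHat, component_exp_ιHat,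
    ← map_mul]
  refine (Ideal.Quotient.mk_eq_mk_iff_sub_mem _ _).2 ?_
  -- If the two sides differed modulo `F^p`, a form `g` killing `F^p` would separate them. Since
  -- `F^p` contains `cof p`, such a `g` belongs to `U^c(K)`, where the hypothesis equates the two
  -- pairings.
  by_contra hd
  obtain ⟨g, hg, hker⟩ := Submodule.exists_le_ker_of_notMem
    (p := (fil F.sub p).restrictScalars k) hd
  let f : F.Uc := ⟨WithConv.toConv g, F.mem_ucSub.2
    ⟨p, fun u hu => hker (UniversalEnvelopingAlgebra.cof_le_fil _ _ hu)⟩⟩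
  have h1 : F.expChar c f = g (truncExp k p c) := F.expChar_eq c fun u hu =>
    hker (UniversalEnvelopingAlgebra.aug_pow_le_fil _ _ hu)
  obtain ⟨N₀, hN₀⟩ := F.expChar_tensor a b (Coalgebra.comul (R := k) f)
  -- The truncation must be long enough for all tensor factors of the coproduct of `f`. Afterwards
  -- it can be cut back to `p`, because the difference lies in the two-sided ideal `F^p`, which `g`
  -- kills.
  have h2 := hN₀ (max N₀ p) (le_max_left _ _)
  have h3 : F.pair (Coalgebra.comul (R := k) f)
      (truncExp k (max N₀ p) a ⊗ₜ truncExp k (max N₀ p) b) =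
      g (truncExp k (max N₀ p) a * truncExp k (max N₀ p) b) := F.pair_comulUc f _ _
  have h4 : g (truncExp k (max N₀ p) a * truncExp k (max N₀ p) b) =
      g (truncExp k p a * truncExp k p b) := by
    rw [← sub_eq_zero, ← map_sub]
    refine hker ((Ideal.Quotient.mk_eq_mk_iff_sub_mem _ _).1 ?_)
    have h5 : ∀ x : L, Ideal.Quotient.mk (fil F.sub p) (truncExp k (max N₀ p) x) =
        Ideal.Quotient.mk (fil F.sub p) (truncExp k p x) := fun x =>
      (Ideal.Quotient.mk_eq_mk_iff_sub_mem _ _).2 (F.truncExp_sub_mem_fil (le_max_right _ _) x)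
    rw [map_mul, map_mul, h5, h5]
  refine hg ?_
  rw [map_sub, sub_eq_zero, ← h1, h f, h2, h3, h4]

end CompleteLieFiltration

end

/-! ### Transport of the coproduct and construction of the group law. -/

theorem mainTheorem2 {k : Type*} [Field k] [CharZero k] {L : Type*} [LieRing L] [LieAlgebra k L]
    (F : CompleteLieFiltration k L) :
    -- the isomorphism `ψ : Sym(K) ≅ U^c(K)` extending the section of `U^c(K) → K` with image
    -- the image of the Euler idempotent
    ∃ ψ : SymmetricAlgebra k F.K ≃ₐ[k] F.Uc,
      (∀ κ : F.K, F.res (ψ (SymmetricAlgebra.ι k F.K κ)) = κ) ∧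
      (∀ f : F.Uc, ψ (SymmetricAlgebra.ι k F.K (F.res f)) = F.euler f) ∧
    -- the Baker-Campbell-Hausdorff product on `L ⊆ Û(L)`
    ∃ μ : L × L → L,
      (∀ a b c : L,
        F.ιHat c = F.log (F.exp (F.ιHat a) * F.exp (F.ιHat b)) ↔ c = μ (a, b)) ∧
      AffineSpace.IsMorphism F.prodDualEquiv F.dualEquiv μ ∧
      -- its homomorphism of coordinate rings is the coproduct of `U^c(K)`
      ∃ φ : SymmetricAlgebra k F.K →ₐ[k] SymmetricAlgebra k (F.K × F.K),
        (∀ φ', AffineSpace.IsComorphism F.prodDualEquiv F.dualEquiv μ φ' ↔ φ' = φ) ∧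
        ∀ s, Algebra.TensorProduct.map (ψ : SymmetricAlgebra k F.K →ₐ[k] F.Uc)
          (ψ : SymmetricAlgebra k F.K →ₐ[k] F.Uc) (AffineSpace.symProd k F.K F.K (φ s)) =
            Coalgebra.comul (R := k) (ψ s) := by
  obtain ⟨ψ, hψ1, hψ2, hψ3⟩ := F.exists_symEquiv
  -- `φ` is the coproduct carried over by `ψ`, so the compatibility of the third part holds by
  -- construction; what remains is to find the map it is pullback along.
  let φ : SymmetricAlgebra k F.K →ₐ[k] SymmetricAlgebra k (F.K × F.K) :=
    (AffineSpace.symProd k F.K F.K).symm.toAlgHom.comp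
      ((Algebra.TensorProduct.congr ψ ψ).symm.toAlgHom.comp
        ((Bialgebra.comulAlgHom k F.Uc).comp (ψ : SymmetricAlgebra k F.K →ₐ[k] F.Uc)))
  have hφ : ∀ s, Algebra.TensorProduct.congr ψ ψ (AffineSpace.symProd k F.K F.K (φ s)) =
      Coalgebra.comul (R := k) (ψ s) := fun s => by
    change Algebra.TensorProduct.congr ψ ψ (AffineSpace.symProd k F.K F.K
      ((AffineSpace.symProd k F.K F.K).symm ((Algebra.TensorProduct.congr ψ ψ).symm
        (Coalgebra.comul (R := k) (ψ s))))) = _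
    rw [AlgEquiv.apply_symm_apply, AlgEquiv.apply_symm_apply]
  -- Evaluation of `φ` at the point `v` is a character of `Sym(K)`. Its restriction to `K` is a
  -- linear form, hence a point of `L` by completeness.
  let μ : L × L → L := fun v => F.dualEquiv.symm
    ((AffineSpace.ev (F.prodDualEquiv v)).toLinearMap ∘ₗ φ.toLinearMap ∘ₗ SymmetricAlgebra.ι k F.K)
  have hμ : AffineSpace.IsComorphism F.prodDualEquiv F.dualEquiv μ φ := fun v s => by
    have h : (AffineSpace.ev (F.prodDualEquiv v)).comp φ =
        AffineSpace.ev (F.dualEquiv (μ v)) := by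
      apply SymmetricAlgebra.algHom_ext
      refine LinearMap.ext fun κ => ?_
      change _ = AffineSpace.ev (F.dualEquiv (μ v)) (SymmetricAlgebra.ι k F.K κ)
      rw [AffineSpace.ev_ι, LinearEquiv.apply_symm_apply]
      rfl
    exact congr($h s)
  -- Writing `f = ψ s`, the pairing with `exp (μ (a, b))` is `s` at `μ (a, b)`, hence `φ s` at `(a,
  -- b)`, hence the coproduct of `f` paired with `exp a ⊗ exp b`.
  have hexp : ∀ a b, F.exp (F.ιHat (μ (a, b))) = F.exp (F.ιHat a) * F.exp (F.ιHat b) :=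
    fun a b => F.exp_eq_mul_of_expChar fun f => by
      obtain ⟨s, rfl⟩ := ψ.surjective f
      rw [hψ3, ← hμ, F.ev_prodDualEquiv, ← hφ]
      generalize AffineSpace.symProd k F.K F.K (φ s) = t
      induction t with
      | zero => simp
      | add x y hx hy => simp only [map_add, hx, hy]
      | tmul x y =>
        rw [Algebra.TensorProduct.congr_apply, Algebra.TensorProduct.map_tmul,
          TensorProduct.map_tmul, TensorProduct.map_tmul]
        exact congrArg₂ (· * ·) (hψ3 a x).symm (hψ3 b y).symm
  refine ⟨ψ, hψ1, hψ2, μ, fun a b c => ?_, hμ.isMorphism F.filtrationProd F.filtrationK, φ,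
    fun φ' => ⟨fun h' => AlgHom.ext fun s => AffineSpace.ext_ev fun v => ?_, fun h => h ▸ hμ⟩, hφ⟩
  · rw [← hexp, F.log_exp]
    exact F.ιHat_injective.eq_iff
  -- Any other pullback along `μ` has the same values at all points of `L × L`, which are all the
  -- linear forms on `K ⊕ K`; over an infinite field this forces equality.
  · obtain ⟨v, rfl⟩ := F.prodDualEquiv.surjective v
    rw [h', hμ]
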